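/- By a compact Riemannian manifold $(M,g)$ we mean a compact connected smooth orientable manifold $M$ without boundary with a smooth Riemannian metric $g$; $\Gamma(TM)$ and $C^\infty(M)$ denote its smooth vector fields and smooth real functions, $\nabla$ the Levi-Civita connection, $\mathrm{grad}_g$ the gradient and $\mathrm{div}_g$ the divergence of $g$. The incompressible Euler equations on $(M,g)$, for $u(t)\in\Gamma(TM)$ and $p(t)\in C^\infty(M)$, are $$\partial_t u+\nabla_u u=-\mathrm{grad}_g\,p,\qquad \mathrm{div}_g\,u=0 .$$ A symmetric bilinear map $B\colon\mathbb R^n\times\mathbb R^n\to\mathbb R^n$ can be embedded into the Euler equations on $(M,g)$ if there are an injective linear map $U\colon\mathbb R^n\to\Gamma(TM)$ and a map $P\colon\mathbb R^n\to C^\infty(M)$ such that, whenever $y$ solves $\partial_t y=B(y,y)$ on some time interval $I$, the fields $u(t)=U(y(t))$ and $p(t)=P(y(t))$ solve the Euler equations on $I$. **Theorem.** Let $B\colon\mathbb R^n\times\mathbb R^n\to\mathbb R^n$ be a symmetric bilinear map. Then the following are equivalent: (i) $B$ can be embedded into the Euler equations on some compact Riemannian manifold $(M,g)$. (ii) There is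 a positive definite inner product $\langle\cdot,\cdot\rangle$ on $\mathbb R^n$ such that $\langle B(y,y),y\rangle=0$ for all $y\in\mathbb R^n$. -/

import Mathlib

open Bundle Set
open scoped Manifold ContDiff

noncomputable section

namespace EulerEmbedding

section Operators

variable {E : Type*} [NormedAddCommGroup E] [NormedSpace ℝ E]
  {M : Type*} [TopologicalSpace M] [ChartedSpace E M]

variable (E M) in
/-- The space `Γ(TM)` of smooth vector fields on `M`. -/
abbrev VectorFields [IsManifold 𝓘(ℝ, E) ∞ M] : Type _ :=
  Cₛ^∞⟮𝓘(ℝ, E); E, (TangentSpace 𝓘(ℝ, E) : M → Type _)⟯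

variable (E M) in
/-- The space `C^∞(M)` of smooth scalar fields on `M`. -/
abbrev ScalarFields : Type _ := C^∞⟮𝓘(ℝ, E), M; 𝓘(ℝ, ℝ), ℝ⟯

variable (E M) in
/-- Smooth Riemannian metrics on `M`. -/
abbrev RiemMetric [IsManifold 𝓘(ℝ, E) ∞ M] : Type _ :=
  ContMDiffRiemannianMetric 𝓘(ℝ, E) ∞ E (TangentSpace 𝓘(ℝ, E) : M → Type _)

variable (E M) in
/-- Affine connections on `M`; `cov Y x v` is `∇_v Y` at the point `x`. -/
abbrev Connection [IsManifold 𝓘(ℝ, E) ∞ M] : Type _ :=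
  CovariantDerivative 𝓘(ℝ, E) E (TangentSpace 𝓘(ℝ, E) : M → Type _)

variable [IsManifold 𝓘(ℝ, E) ∞ M]

variable (E M) in
/-- `M` is orientable: it carries a smooth nowhere vanishing differential form of top degree.
Smoothness of the form is expressed by evaluating it on smooth vector fields. -/
def IsOrientable : Prop :=
  ∃ vol : (x : M) → TangentSpace 𝓘(ℝ, E) x [⋀^Fin (Module.finrank ℝ E)]→ₗ[ℝ] ℝ,
    (∀ x, vol x ≠ 0) ∧
    ∀ X : Fin (Module.finrank ℝ E) → VectorFields E M,
      ContMDiff 𝓘(ℝ, E) 𝓘(ℝ, ℝ) ∞ (fun x ↦ vol x (fun i ↦ X i x))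

/-- The Levi-Civita connection of `g` is the connection `∇` that is
torsion free, `∇_X Y - ∇_Y X = [X, Y]`, and
compatible with the metric, `d(g(Y, Z))(v) = g(∇_v Y, Z) + g(Y, ∇_v Z)`. -/
structure IsLeviCivita (g : RiemMetric E M) (cov : Connection E M) : Prop where
  torsion_free : ∀ (X Y : (x : M) → TangentSpace 𝓘(ℝ, E) x) (x : M),
    MDiffAt (T% X) x → MDiffAt (T% Y) x →
      cov Y x (X x) - cov X x (Y x) = VectorField.mlieBracket 𝓘(ℝ, E) X Y x
  metric_compatible : ∀ (Y Z : (x : M) → TangentSpace 𝓘(ℝ, E) x) (x : M),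
    MDiffAt (T% Y) x → MDiffAt (T% Z) x → ∀ v : TangentSpace 𝓘(ℝ, E) x,
      mvfderiv 𝓘(ℝ, E) (fun z ↦ g.inner z (Y z) (Z z)) x v =
        g.inner x (cov Y x v) (Z x) + g.inner x (Y x) (cov Z x v)

/-- The divergence of a vector field with respect to a connection `∇`: the trace of the
endomorphism `v ↦ ∇_v X` of each tangent space. For the Levi-Civita connection of `g` this is
the divergence `div_g`. -/
def divergence (cov : Connection E M) (X : (x : M) → TangentSpace 𝓘(ℝ, E) x) (x : M) : ℝ :=
  LinearMap.trace ℝ (TangentSpace 𝓘(ℝ, E) x) (cov X x).toLinearMap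

/-- The inner product of `g` on the tangent space at `x`, as a bilinear form. -/
def metricForm (g : RiemMetric E M) (x : M) : LinearMap.BilinForm ℝ (TangentSpace 𝓘(ℝ, E) x) :=
  (g.inner x).toLinearMap₁₂

theorem metricForm_apply (g : RiemMetric E M) (x : M) (v w : TangentSpace 𝓘(ℝ, E) x) :
    metricForm g x v w = g.inner x v w := rfl

theorem metricForm_nondegenerate (g : RiemMetric E M) (x : M) : (metricForm g x).Nondegenerate := by
  refine ⟨fun v hv ↦ ?_, fun v hv ↦ ?_⟩ <;>
  · by_contra h
    exact (g.pos x v h).ne' (hv v)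

variable [FiniteDimensional ℝ E]

instance finiteDimensional_tangentSpace (x : M) : FiniteDimensional ℝ (TangentSpace 𝓘(ℝ, E) x) :=
  inferInstanceAs (FiniteDimensional ℝ E)

/-- The gradient `grad_g f`: the vector field with `g(grad_g f, v) = df(v)` for all `v`. -/
def gradient (g : RiemMetric E M) (f : M → ℝ) (x : M) : TangentSpace 𝓘(ℝ, E) x :=
  (LinearMap.BilinForm.toDual (metricForm g x) (metricForm_nondegenerate g x)).symm
    (mvfderiv 𝓘(ℝ, E) f x).toLinearMap

theorem inner_gradient (g : RiemMetric E M) (f : M → ℝ) (x : M) (v : TangentSpace 𝓘(ℝ, E) x) :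
    g.inner x (gradient g f x) v = mvfderiv 𝓘(ℝ, E) f x v :=
  LinearMap.BilinForm.apply_toDual_symm_apply (B := metricForm g x)
    (hB := metricForm_nondegenerate g x) (mvfderiv 𝓘(ℝ, E) f x).toLinearMap v

end Operators

/-- A compact Riemannian manifold: a compact connected Hausdorff smooth orientable manifold
without boundary, of finite dimension, with a smooth Riemannian metric. The charts take values in
a finite-dimensional real normed space `E`, so that there is no boundary. -/
structure CompactRiemannianManifold where
  E : Type
  [normedAddCommGroup : NormedAddCommGroup E]
  [normedSpace : NormedSpace ℝ E]
  [finiteDimensional : FiniteDimensional ℝ E]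
  M : Type
  [topologicalSpace : TopologicalSpace M]
  [chartedSpace : ChartedSpace E M]
  [isManifold : IsManifold 𝓘(ℝ, E) ∞ M]
  [t2Space : T2Space M]
  [compactSpace : CompactSpace M]
  [connectedSpace : ConnectedSpace M]
  orientable : IsOrientable E M
  g : RiemMetric E M

attribute [instance] CompactRiemannianManifold.normedAddCommGroup
  CompactRiemannianManifold.normedSpace CompactRiemannianManifold.finiteDimensional
  CompactRiemannianManifold.topologicalSpace CompactRiemannianManifold.chartedSpace
  CompactRiemannianManifold.isManifold CompactRiemannianManifold.t2Space
  CompactRiemannianManifold.compactSpace CompactRiemannianManifold.connectedSpace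

/-- A time interval: an interval of the real line with more than one point. -/
def IsTimeInterval (J : Set ℝ) : Prop := J.OrdConnected ∧ J.Nontrivial

/-- The incompressible Euler equations
`∂ₜ u + ∇_u u = - grad_g p`, `div_g u = 0` on the time interval `J`, where `cov` is the
Levi-Civita connection. The time derivative at an end point of `J` is one-sided. -/
def SolvesEulerOn (N : CompactRiemannianManifold) (cov : Connection N.E N.M)
    (u : ℝ → VectorFields N.E N.M) (p : ℝ → ScalarFields N.E N.M) (J : Set ℝ) : Prop :=
  ∀ t ∈ J, ∀ x : N.M,
    (∃ dudt : TangentSpace 𝓘(ℝ, N.E) x,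
      HasDerivWithinAt (fun s ↦ u s x) dudt J t ∧
      dudt + cov (u t) x (u t x) = - gradient N.g (p t) x) ∧
    divergence cov (u t) x = 0

/-- `y` solves the ODE `∂ₜ y = B(y, y)` on `J`. -/
def SolvesODEOn {V : Type*} [NormedAddCommGroup V] [NormedSpace ℝ V] (B : V →ₗ[ℝ] V →ₗ[ℝ] V)
    (y : ℝ → V) (J : Set ℝ) : Prop :=
  ∀ t ∈ J, HasDerivWithinAt y (B (y t) (y t)) J t

/-- `B` can be linearly embedded into the Euler equations on `N`. -/
def EmbedsIntoEuler {V : Type*} [NormedAddCommGroup V] [NormedSpace ℝ V]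
    (B : V →ₗ[ℝ] V →ₗ[ℝ] V) (N : CompactRiemannianManifold) : Prop :=
  ∃ cov : Connection N.E N.M, IsLeviCivita N.g cov ∧
  ∃ (U : V →ₗ[ℝ] VectorFields N.E N.M) (P : V → ScalarFields N.E N.M),
    Function.Injective U ∧
    ∀ (J : Set ℝ) (y : ℝ → V), IsTimeInterval J → SolvesODEOn B y J →
      SolvesEulerOn N cov (fun t ↦ U (y t)) (fun t ↦ P (y t)) J

end EulerEmbedding

end

/-!
If `U` embeds `B`, the pulled back kinetic energy `Q(y, z) = ∫ g(U y, U z) dvol` is positive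
definite since `U` is injective. Through every `y` passes a solution, so the field `u = U y` is
divergence free and `U (B(y, y)) = -∇_u u - grad (P y)`, which makes
`Q(B(y, y), y) = -∫ u (|u|² / 2 + P y) dvol` vanish by the divergence theorem.

Conversely, identify `Q` with the Euclidean inner product of `ℝⁿ`. Since `B(y, y)` is orthogonal
to `y`, it equals `-A(y) y` for some `A(y) ∈ 𝔰𝔬(n)` depending linearly on `y`. If the tangent
bundle of a manifold has a global frame whose brackets are those of a unimodular Lie algebra,
then for the metric making the frame orthonormal the Euler equations for fields with constant
coefficients and zero pressure become the Euler-Arnold equation `u' = (ad u)† u`. The manifold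
`Tⁿ × SO(n)` carries such a frame with the Lie algebra `ℝⁿ ⋊ 𝔰𝔬(n)` of Euclidean motions. For an
inner product in which `y ↦ (y, A(y))` is isometric and orthogonal to `0 × 𝔰𝔬(n)`, the
Euler-Arnold equation preserves the subspace of all `(y, A(y))` and restricts to `y' = -A(y) y`
there.
-/

noncomputable section

namespace EulerEmbedding

open VectorField Filter
open scoped Topology InnerProductSpace

/-! ### Calculus in charts -/

section Charts

variable {E : Type*} [NormedAddCommGroup E] [NormedSpace ℝ E]
  {M : Type*} [TopologicalSpace M] [ChartedSpace E M]
  {F : Type*} [NormedAddCommGroup F] [NormedSpace ℝ F]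

/-- The derivative at `e` of the inverse of the chart at `c`. -/
def chartDeriv (c : M) (e : E) : E →L[ℝ] TangentSpace 𝓘(ℝ, E) ((extChartAt 𝓘(ℝ, E) c).symm e) :=
  mfderiv 𝓘(ℝ, E) 𝓘(ℝ, E) (extChartAt 𝓘(ℝ, E) c).symm e

/-- The expression of a vector field in the chart at `c`. -/
def fieldInChart (c : M) (X : (x : M) → TangentSpace 𝓘(ℝ, E) x) (e : E) : E :=
  mpullback 𝓘(ℝ, E) 𝓘(ℝ, E) (extChartAt 𝓘(ℝ, E) c).symm X e

theorem extChartAt_target_mem_nhds_of_mem (c : M) {e : E}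
    (he : e ∈ (extChartAt 𝓘(ℝ, E) c).target) : (extChartAt 𝓘(ℝ, E) c).target ∈ 𝓝 e :=
  (isOpen_extChartAt_target c).mem_nhds he

theorem exists_extChartAt_symm_eq (x : M) :
    ∃ c : M, ∃ e ∈ (extChartAt 𝓘(ℝ, E) c).target, (extChartAt 𝓘(ℝ, E) c).symm e = x :=
  ⟨x, _, mem_extChartAt_target x, extChartAt_to_inv x⟩

variable [IsManifold 𝓘(ℝ, E) ∞ M] (c : M) {e : E}

theorem contMDiffAt_extChartAt_symm (he : e ∈ (extChartAt 𝓘(ℝ, E) c).target) :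
    ContMDiffAt 𝓘(ℝ, E) 𝓘(ℝ, E) ∞ (extChartAt 𝓘(ℝ, E) c).symm e :=
  (contMDiffOn_extChartAt_symm c).contMDiffAt (extChartAt_target_mem_nhds_of_mem c he)

theorem isInvertible_mfderiv_extChartAt_symm (he : e ∈ (extChartAt 𝓘(ℝ, E) c).target) :
    (mfderiv 𝓘(ℝ, E) 𝓘(ℝ, E) (extChartAt 𝓘(ℝ, E) c).symm e).IsInvertible := by
  have h := isInvertible_mfderivWithin_extChartAt_symm (I := 𝓘(ℝ, E)) he
  rwa [ModelWithCorners.range_eq_univ, mfderivWithin_univ] at h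

theorem isInvertible_chartDeriv (he : e ∈ (extChartAt 𝓘(ℝ, E) c).target) :
    (chartDeriv c e).IsInvertible :=
  isInvertible_mfderiv_extChartAt_symm c he

theorem chartDeriv_fieldInChart (he : e ∈ (extChartAt 𝓘(ℝ, E) c).target)
    (X : (x : M) → TangentSpace 𝓘(ℝ, E) x) :
    chartDeriv c e (fieldInChart c X e) = X ((extChartAt 𝓘(ℝ, E) c).symm e) :=
  (isInvertible_chartDeriv c he).self_apply_inverse _

theorem differentiableAt_fieldInChart [CompleteSpace E]
    (he : e ∈ (extChartAt 𝓘(ℝ, E) c).target) {X : (x : M) → TangentSpace 𝓘(ℝ, E) x}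
    (hX : MDiffAt (T% X) ((extChartAt 𝓘(ℝ, E) c).symm e)) :
    DifferentiableAt ℝ (fieldInChart c X) e := by
  have hX' := hX.mpullback_vectorField (contMDiffAt_extChartAt_symm c he)
    (isInvertible_mfderiv_extChartAt_symm c he) ENat.LEInfty.out
  have h : MDiffAt (fieldInChart c X) e :=
    ((contMDiff_snd_tangentBundle_modelSpace E 𝓘(ℝ, E) (n := 1)).mdifferentiable
      one_ne_zero _).comp e hX'
  exact h.differentiableAt

theorem contDiffAt_fieldInChart [CompleteSpace E]
    (he : e ∈ (extChartAt 𝓘(ℝ, E) c).target) {X : (x : M) → TangentSpace 𝓘(ℝ, E) x}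
    (hX : CMDiffAt ∞ (T% X) ((extChartAt 𝓘(ℝ, E) c).symm e)) :
    ContDiffAt ℝ ∞ (fieldInChart c X) e :=
  (contMDiffAt_vectorSpace_iff_contDiffAt (V := fieldInChart c X)).1 <|
    hX.mpullback_vectorField_preimage (contMDiffAt_extChartAt_symm c he)
      (isInvertible_mfderiv_extChartAt_symm c he) (by simp)

theorem fieldInChart_mlieBracket [CompleteSpace E]
    (he : e ∈ (extChartAt 𝓘(ℝ, E) c).target) {X Y : (x : M) → TangentSpace 𝓘(ℝ, E) x}
    (hX : MDiffAt (T% X) ((extChartAt 𝓘(ℝ, E) c).symm e))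
    (hY : MDiffAt (T% Y) ((extChartAt 𝓘(ℝ, E) c).symm e)) :
    fieldInChart c (mlieBracket 𝓘(ℝ, E) X Y) e =
      lieBracket ℝ (fieldInChart c X) (fieldInChart c Y) e := by
  have : IsManifold 𝓘(ℝ, E) (minSmoothness ℝ 3) M := by
    rw [minSmoothness_of_isRCLikeNormedField]
    infer_instance
  have h := mpullback_mlieBracket (n := ∞) hX hY (contMDiffAt_extChartAt_symm c he)
    (by rw [minSmoothness_of_isRCLikeNormedField]; exact ENat.LEInfty.out)
  rw [← mlieBracketWithin_univ (I := 𝓘(ℝ, E)) (M := E),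
    mlieBracketWithin_eq_lieBracketWithin] at h
  exact h.trans (congrFun lieBracketWithin_univ e)

theorem hasFDerivAt_comp_extChartAt_symm (he : e ∈ (extChartAt 𝓘(ℝ, E) c).target) {f : M → F}
    (hf : MDiffAt f ((extChartAt 𝓘(ℝ, E) c).symm e)) :
    HasFDerivAt (f ∘ (extChartAt 𝓘(ℝ, E) c).symm)
      (mvfderiv 𝓘(ℝ, E) f ((extChartAt 𝓘(ℝ, E) c).symm e) ∘L chartDeriv c e) e :=
  (hf.hasMFDerivAt.comp e ((contMDiffAt_extChartAt_symm c he).mdifferentiableAt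
    (by simp)).hasMFDerivAt).hasFDerivAt

theorem contDiffAt_comp_extChartAt_symm (he : e ∈ (extChartAt 𝓘(ℝ, E) c).target) {f : M → F}
    (hf : CMDiffAt ∞ f ((extChartAt 𝓘(ℝ, E) c).symm e)) :
    ContDiffAt ℝ ∞ (f ∘ (extChartAt 𝓘(ℝ, E) c).symm) e :=
  contMDiffAt_iff_contDiffAt.1 (hf.comp e (contMDiffAt_extChartAt_symm c he))

theorem fderiv_comp_extChartAt_symm_fieldInChart (he : e ∈ (extChartAt 𝓘(ℝ, E) c).target)
    {f : M → F} (hf : MDiffAt f ((extChartAt 𝓘(ℝ, E) c).symm e))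
    (X : (x : M) → TangentSpace 𝓘(ℝ, E) x) :
    fderiv ℝ (f ∘ (extChartAt 𝓘(ℝ, E) c).symm) e (fieldInChart c X e) =
      mvfderiv 𝓘(ℝ, E) f ((extChartAt 𝓘(ℝ, E) c).symm e)
        (X ((extChartAt 𝓘(ℝ, E) c).symm e)) := by
  rw [(hasFDerivAt_comp_extChartAt_symm c he hf).fderiv, ContinuousLinearMap.comp_apply,
    chartDeriv_fieldInChart c he]

theorem mdifferentiableAt_mvfderiv_apply {f : M → F} (hf : CMDiff ∞ f)
    {X : (x : M) → TangentSpace 𝓘(ℝ, E) x} {x : M} (hX : MDiffAt (T% X) x) :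
    MDiffAt (fun z ↦ mvfderiv 𝓘(ℝ, E) f z (X z)) x := by
  have h : MDifferentiableAt 𝓘(ℝ, E) _ (fun z ↦ tangentMap 𝓘(ℝ, E) 𝓘(ℝ, F) f ⟨z, X z⟩) x :=
    ((hf.contMDiff_tangentMap (m := ∞) (by simp)).mdifferentiable (by simp) _).comp x hX
  exact ((contMDiff_snd_tangentBundle_modelSpace F 𝓘(ℝ, F) (n := 1)).mdifferentiable
    one_ne_zero _).comp x h

theorem contMDiff_mvfderiv_apply {f : M → F} (hf : CMDiff ∞ f)
    {X : (x : M) → TangentSpace 𝓘(ℝ, E) x} (hX : CMDiff ∞ (T% X)) :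
    CMDiff ∞ (fun z ↦ mvfderiv 𝓘(ℝ, E) f z (X z)) := by
  have h : ContMDiff 𝓘(ℝ, E) _ ∞ (fun z ↦ tangentMap 𝓘(ℝ, E) 𝓘(ℝ, F) f ⟨z, X z⟩) :=
    (hf.contMDiff_tangentMap (m := ∞) (by simp)).comp hX
  exact (contMDiff_snd_tangentBundle_modelSpace F 𝓘(ℝ, F)).comp h

theorem mvfderiv_mvfderiv_apply [CompleteSpace E] (he : e ∈ (extChartAt 𝓘(ℝ, E) c).target)
    {f : M → F} (hf : CMDiff ∞ f) {X : (x : M) → TangentSpace 𝓘(ℝ, E) x}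
    (hX : MDiffAt (T% X) ((extChartAt 𝓘(ℝ, E) c).symm e)) (v : E) :
    mvfderiv 𝓘(ℝ, E) (fun z ↦ mvfderiv 𝓘(ℝ, E) f z (X z)) ((extChartAt 𝓘(ℝ, E) c).symm e)
        (chartDeriv c e v) =
      fderiv ℝ (fderiv ℝ (f ∘ (extChartAt 𝓘(ℝ, E) c).symm)) e v (fieldInChart c X e) +
        fderiv ℝ (f ∘ (extChartAt 𝓘(ℝ, E) c).symm) e (fderiv ℝ (fieldInChart c X) e v) := by
  have hff : DifferentiableAt ℝ (fderiv ℝ (f ∘ (extChartAt 𝓘(ℝ, E) c).symm)) e :=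
    ((contDiffAt_comp_extChartAt_symm c he hf.contMDiffAt).fderiv_right (m := 1)
      (by rw [one_add_one_eq_two]; exact ENat.LEInfty.out)).differentiableAt one_ne_zero
  have hprod := hff.hasFDerivAt.clm_apply (differentiableAt_fieldInChart c he hX).hasFDerivAt
  have hchain := hasFDerivAt_comp_extChartAt_symm c he (mdifferentiableAt_mvfderiv_apply hf hX)
  have h := hchain.unique <| hprod.congr_of_eventuallyEq <| by
    filter_upwards [extChartAt_target_mem_nhds_of_mem c he] with e' he'
    exact (fderiv_comp_extChartAt_symm_fieldInChart c he' (hf.mdifferentiable (by simp) _) X).symm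
  exact (DFunLike.congr_fun h v).trans (add_comm _ _)

theorem mvfderiv_mlieBracket [CompleteSpace E] {f : M → F} (hf : CMDiff ∞ f)
    {X Y : (x : M) → TangentSpace 𝓘(ℝ, E) x} {x : M}
    (hX : MDiffAt (T% X) x) (hY : MDiffAt (T% Y) x) :
    mvfderiv 𝓘(ℝ, E) f x (mlieBracket 𝓘(ℝ, E) X Y x) =
      mvfderiv 𝓘(ℝ, E) (fun z ↦ mvfderiv 𝓘(ℝ, E) f z (Y z)) x (X x) -
        mvfderiv 𝓘(ℝ, E) (fun z ↦ mvfderiv 𝓘(ℝ, E) f z (X z)) x (Y x) := by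
  obtain ⟨c, e, he, rfl⟩ := exists_extChartAt_symm_eq (E := E) x
  have hsymm : IsSymmSndFDerivAt ℝ (f ∘ (extChartAt 𝓘(ℝ, E) c).symm) e :=
    (contDiffAt_comp_extChartAt_symm c he hf.contMDiffAt).isSymmSndFDerivAt
      (by rw [minSmoothness_of_isRCLikeNormedField]; exact ENat.LEInfty.out)
  rw [← fderiv_comp_extChartAt_symm_fieldInChart c he (hf.mdifferentiable (by simp) _),
    fieldInChart_mlieBracket c he hX hY, lieBracket, map_sub,
    ← chartDeriv_fieldInChart c he X, ← chartDeriv_fieldInChart c he Y,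
    mvfderiv_mvfderiv_apply c he hf hX, mvfderiv_mvfderiv_apply c he hf hY, hsymm.eq]
  abel

end Charts

/-! ### The Riemannian density -/

section Jacobi

variable {E : Type*} [NormedAddCommGroup E] [NormedSpace ℝ E] {ι : Type*} [Fintype ι]
  [DecidableEq ι]

theorem fderiv_det_apply {A : E → Matrix ι ι ℝ} {e : E}
    (hA : ∀ i j, DifferentiableAt ℝ (fun x ↦ A x i j) e) (v : E) :
    fderiv ℝ (fun x ↦ (A x).det) e v =
      ((A e).adjugate * Matrix.of fun i j ↦ fderiv ℝ (fun x ↦ A x i j) e v).trace := by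
  let det : ContinuousMultilinearMap ℝ (fun _ : ι ↦ ι → ℝ) ℝ :=
    { toMultilinearMap := Matrix.detRowAlternating.toMultilinearMap
      cont := Continuous.matrix_det continuous_id }
  have hrows : HasFDerivAt (fun x i ↦ (A x i : ι → ℝ)) _ e :=
    hasFDerivAt_pi.2 fun i ↦ hasFDerivAt_pi.2 fun j ↦ (hA i j).hasFDerivAt
  have hdet : HasFDerivAt (fun x ↦ (A x).det) _ e :=
    HasFDerivAt.comp (g := det) (f := fun x i ↦ (A x i : ι → ℝ)) e (det.hasFDerivAt _) hrows
  have hcofactor (i : ι) :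
      det (Function.update (fun i ↦ A e i) i fun j ↦ fderiv ℝ (fun x ↦ A x i j) e v) =
        ∑ j, (A e).adjugate j i * fderiv ℝ (fun x ↦ A x i j) e v := by
    change ((A e).updateRow i fun j ↦ fderiv ℝ (fun x ↦ A x i j) e v).det = _
    rw [← Matrix.cramer_transpose_apply, Matrix.cramer_eq_adjugate_mulVec,
      ← Matrix.adjugate_transpose]
    rfl
  rw [hdet.fderiv, ContinuousLinearMap.comp_apply, ContinuousMultilinearMap.linearDeriv_apply]
  refine (Finset.sum_congr rfl fun i _ ↦ hcofactor i).trans ?_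
  rw [Finset.sum_comm]
  rfl

end Jacobi

theorem trace_adjugate_mul_transpose_mul_add_mul {ι R : Type*} [Fintype ι] [DecidableEq ι]
    [CommRing R] (G N : Matrix ι ι R) :
    (G.adjugate * (N.transpose * G + G * N)).trace = 2 * G.det * N.trace := by
  have hleft : (G.adjugate * (N.transpose * G)).trace = G.det * N.trace := by
    rw [← mul_assoc, Matrix.trace_mul_comm, ← mul_assoc, Matrix.mul_adjugate, smul_mul_assoc,
      one_mul, Matrix.trace_smul, Matrix.trace_transpose, smul_eq_mul]
  have hright : (G.adjugate * (G * N)).trace = G.det * N.trace := by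
    rw [← mul_assoc, Matrix.adjugate_mul, smul_mul_assoc, one_mul, Matrix.trace_smul, smul_eq_mul]
  rw [mul_add, Matrix.trace_add, hleft, hright]
  ring

section TraceFDeriv

variable {E : Type*} [NormedAddCommGroup E] [NormedSpace ℝ E] [FiniteDimensional ℝ E]

theorem trace_fderiv_smul {f : E → ℝ} {X : E → E} {e : E} (hf : DifferentiableAt ℝ f e)
    (hX : DifferentiableAt ℝ X e) :
    LinearMap.trace ℝ E (fderiv ℝ (f • X) e).toLinearMap =
      f e * LinearMap.trace ℝ E (fderiv ℝ X e).toLinearMap + fderiv ℝ f e (X e) := by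
  rw [fderiv_smul hf hX, ContinuousLinearMap.toLinearMap_add, map_add,
    ContinuousLinearMap.toLinearMap_smul, map_smul, smul_eq_mul]
  exact congrArg (_ + ·) (LinearMap.trace_smulRight _ _)

end TraceFDeriv

section CoordinateFields

variable {E : Type*} [NormedAddCommGroup E] [NormedSpace ℝ E]
  {M : Type*} [TopologicalSpace M] [ChartedSpace E M]

/-- The coordinate vector field in the direction `v` of the chart at `c`. -/
def coordField (c : M) (v : E) (x : M) : TangentSpace 𝓘(ℝ, E) x :=
  (mfderiv 𝓘(ℝ, E) 𝓘(ℝ, E) (extChartAt 𝓘(ℝ, E) c) x).inverse v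

variable [IsManifold 𝓘(ℝ, E) ∞ M] (c : M) {e : E}

theorem coordField_extChartAt_symm (he : e ∈ (extChartAt 𝓘(ℝ, E) c).target) (v : E) :
    coordField c v ((extChartAt 𝓘(ℝ, E) c).symm e) = chartDeriv c e v := by
  have hcomp := mfderiv_extChartAt_comp_mfderivWithin_extChartAt_symm (I := 𝓘(ℝ, E)) he
  rw [ModelWithCorners.range_eq_univ, mfderivWithin_univ] at hcomp
  have hinv := isInvertible_mfderiv_extChartAt (I := 𝓘(ℝ, E))
    ((extChartAt 𝓘(ℝ, E) c).map_target he)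
  exact hinv.injective ((hinv.self_apply_inverse _).trans (DFunLike.congr_fun hcomp v).symm)

theorem fieldInChart_coordField (he : e ∈ (extChartAt 𝓘(ℝ, E) c).target) (v : E) :
    fieldInChart c (coordField c v) e = v :=
  (isInvertible_chartDeriv c he).injective <|
    (chartDeriv_fieldInChart c he _).trans (coordField_extChartAt_symm c he v)

variable [CompleteSpace E]

theorem contMDiffAt_coordField {x : M} (hx : x ∈ (extChartAt 𝓘(ℝ, E) c).source) (v : E) :
    CMDiffAt ∞ (T% (coordField c v)) x := by
  let V (e : E) : TangentSpace 𝓘(ℝ, E) e := v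
  have hV : CMDiffAt ∞ (T% V) (extChartAt 𝓘(ℝ, E) c x) :=
    (contMDiffAt_vectorSpace_iff_contDiffAt (V := V)).2 contDiffAt_const
  have hchart : CMDiffAt ∞ (extChartAt 𝓘(ℝ, E) c) x := contMDiffAt_extChartAt' (by simpa using hx)
  exact hV.mpullback_vectorField_preimage hchart (isInvertible_mfderiv_extChartAt hx) (by simp)

theorem mdifferentiableAt_coordField (he : e ∈ (extChartAt 𝓘(ℝ, E) c).target) (v : E) :
    MDiffAt (T% (coordField c v)) ((extChartAt 𝓘(ℝ, E) c).symm e) :=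
  (contMDiffAt_coordField c ((extChartAt 𝓘(ℝ, E) c).map_target he) v).mdifferentiableAt (by simp)

theorem chartDeriv_fderiv_fieldInChart (he : e ∈ (extChartAt 𝓘(ℝ, E) c).target)
    {X : (x : M) → TangentSpace 𝓘(ℝ, E) x}
    (hX : MDiffAt (T% X) ((extChartAt 𝓘(ℝ, E) c).symm e)) (v : E) :
    chartDeriv c e (fderiv ℝ (fieldInChart c X) e v) =
      mlieBracket 𝓘(ℝ, E) (coordField c v) X ((extChartAt 𝓘(ℝ, E) c).symm e) := by
  have hconst : fieldInChart c (coordField c v) =ᶠ[𝓝 e] fun _ ↦ v := by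
    filter_upwards [extChartAt_target_mem_nhds_of_mem c he] with z hz
    exact fieldInChart_coordField c hz v
  rw [← chartDeriv_fieldInChart c he (mlieBracket 𝓘(ℝ, E) (coordField c v) X),
    fieldInChart_mlieBracket c he (mdifferentiableAt_coordField c he v) hX, lieBracket,
    hconst.fderiv_eq, fderiv_fun_const, fieldInChart_coordField c he]
  simp

end CoordinateFields

section Density

variable {E : Type*} [NormedAddCommGroup E] [NormedSpace ℝ E]
  {M : Type*} [TopologicalSpace M] [ChartedSpace E M] [IsManifold 𝓘(ℝ, E) ∞ M]
  (g : RiemMetric E M) (c : M) {e : E}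

theorem contMDiffAt_inner {X Y : (x : M) → TangentSpace 𝓘(ℝ, E) x} {x : M}
    (hX : CMDiffAt ∞ (T% X) x) (hY : CMDiffAt ∞ (T% Y) x) :
    CMDiffAt ∞ (fun z ↦ g.inner z (X z) (Y z)) x :=
  (Bundle.contMDiffAt_section (F := ℝ) _).1 <|
    ContMDiffAt.clm_bundle_apply₂ (F₁ := E) (F₂ := E) g.contMDiff.contMDiffAt hX hY

/-- The metric in the chart at `c`. -/
def chartMetric (e : E) : LinearMap.BilinForm ℝ E :=
  (metricForm g ((extChartAt 𝓘(ℝ, E) c).symm e)).comp (chartDeriv c e).toLinearMap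
    (chartDeriv c e).toLinearMap

theorem chartMetric_isSymm (e : E) : (chartMetric g c e).IsSymm :=
  ⟨fun _ _ ↦ g.symm _ _ _⟩

theorem chartMetric_posDef (he : e ∈ (extChartAt 𝓘(ℝ, E) c).target) :
    (chartMetric g c e).toQuadraticMap.PosDef := fun _ hv ↦
  g.pos _ _ fun h0 ↦ hv <| (isInvertible_chartDeriv c he).injective <| h0.trans (map_zero _).symm

theorem chartMetric_eventuallyEq (he : e ∈ (extChartAt 𝓘(ℝ, E) c).target) (v w : E) :
    (fun z ↦ chartMetric g c z v w) =ᶠ[𝓝 e]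
      (fun x ↦ g.inner x (coordField c v x) (coordField c w x)) ∘
        (extChartAt 𝓘(ℝ, E) c).symm := by
  filter_upwards [extChartAt_target_mem_nhds_of_mem c he] with z hz
  rw [Function.comp_apply, coordField_extChartAt_symm c hz, coordField_extChartAt_symm c hz]
  rfl

theorem contDiffAt_chartMetric [CompleteSpace E] (he : e ∈ (extChartAt 𝓘(ℝ, E) c).target)
    (v w : E) : ContDiffAt ℝ ∞ (fun z ↦ chartMetric g c z v w) e := by
  have hx := (extChartAt 𝓘(ℝ, E) c).map_target he
  have hinner := contMDiffAt_inner g (contMDiffAt_coordField c hx v) (contMDiffAt_coordField c hx w)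
  exact (contDiffAt_comp_extChartAt_symm c he hinner).congr_of_eventuallyEq
    (chartMetric_eventuallyEq g c he v w)

section Gram

variable [FiniteDimensional ℝ E]

/-- The Gram matrix `(g_ij)` of the metric in the chart at `c`. -/
def gram (e : E) : Matrix (Fin (Module.finrank ℝ E)) (Fin (Module.finrank ℝ E)) ℝ :=
  LinearMap.BilinForm.toMatrix (Module.finBasis ℝ E) (chartMetric g c e)

theorem gram_apply (e : E) (i j : Fin (Module.finrank ℝ E)) : gram g c e i j =
    chartMetric g c e (Module.finBasis ℝ E i) (Module.finBasis ℝ E j) :=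
  LinearMap.BilinForm.toMatrix_apply _ _ i j

/-- The Riemannian density `√det(g_ij)` in the chart at `c`. -/
def density (e : E) : ℝ := √(gram g c e).det

theorem det_gram_pos (he : e ∈ (extChartAt 𝓘(ℝ, E) c).target) : 0 < (gram g c e).det :=
  ((LinearMap.BilinForm.posDef_toQuadraticMap_iff_matrix _ _ (chartMetric_isSymm g c e)).1
    (chartMetric_posDef g c he)).det_pos

theorem density_pos (he : e ∈ (extChartAt 𝓘(ℝ, E) c).target) : 0 < density g c e :=
  Real.sqrt_pos.2 (det_gram_pos g c he)

theorem contDiffAt_gram (he : e ∈ (extChartAt 𝓘(ℝ, E) c).target)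
    (i j : Fin (Module.finrank ℝ E)) : ContDiffAt ℝ ∞ (fun z ↦ gram g c z i j) e := by
  simpa only [gram_apply] using contDiffAt_chartMetric g c he _ _

theorem contDiffAt_det_gram (he : e ∈ (extChartAt 𝓘(ℝ, E) c).target) :
    ContDiffAt ℝ ∞ (fun z ↦ (gram g c z).det) e := by
  simp only [Matrix.det_apply]
  exact ContDiffAt.sum fun σ _ ↦ ContDiffAt.const_smul _ <|
    contDiffAt_prod fun i _ ↦ contDiffAt_gram g c he _ _

theorem contDiffAt_density (he : e ∈ (extChartAt 𝓘(ℝ, E) c).target) :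
    ContDiffAt ℝ ∞ (density g c) e :=
  (contDiffAt_det_gram g c he).sqrt (det_gram_pos g c he).ne'

end Gram

/-- The endomorphism `v ↦ Γ(v, X)` given by the Christoffel symbols of a connection in the chart
at `c`, that is `v ↦ ∇_v X - ∂_v X`. -/
def christoffel (cov : Connection E M) (X : (x : M) → TangentSpace 𝓘(ℝ, E) x) (e : E) :
    E →ₗ[ℝ] E :=
  (chartDeriv c e).inverse.toLinearMap ∘ₗ
      (cov X ((extChartAt 𝓘(ℝ, E) c).symm e)).toLinearMap ∘ₗ (chartDeriv c e).toLinearMap -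
    (fderiv ℝ (fieldInChart c X) e).toLinearMap

variable {cov : Connection E M} {X : (x : M) → TangentSpace 𝓘(ℝ, E) x}

theorem chartDeriv_christoffel (he : e ∈ (extChartAt 𝓘(ℝ, E) c).target) (v : E) :
    chartDeriv c e (christoffel c cov X e v) =
      cov X ((extChartAt 𝓘(ℝ, E) c).symm e) (chartDeriv c e v) -
        chartDeriv c e (fderiv ℝ (fieldInChart c X) e v) :=
  (map_sub (chartDeriv c e) _ _).trans <| congrArg (· - _) <|
    (isInvertible_chartDeriv c he).self_apply_inverse _

theorem trace_christoffel [FiniteDimensional ℝ E] (he : e ∈ (extChartAt 𝓘(ℝ, E) c).target) :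
    LinearMap.trace ℝ E (christoffel c cov X e) =
      divergence cov X ((extChartAt 𝓘(ℝ, E) c).symm e) -
        LinearMap.trace ℝ E (fderiv ℝ (fieldInChart c X) e).toLinearMap := by
  have hconj : (chartDeriv c e).toLinearMap ∘ₗ (chartDeriv c e).inverse.toLinearMap =
      LinearMap.id := LinearMap.ext (isInvertible_chartDeriv c he).self_apply_inverse
  rw [christoffel, map_sub, LinearMap.trace_comp_comm', LinearMap.comp_assoc, hconj,
    LinearMap.comp_id]
  rfl

variable {g} [CompleteSpace E] (hcov : IsLeviCivita g cov)
  (he : e ∈ (extChartAt 𝓘(ℝ, E) c).target)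
  (hX : MDiffAt (T% X) ((extChartAt 𝓘(ℝ, E) c).symm e))

include hcov he hX

theorem cov_coordField (v : E) :
    cov (coordField c v) ((extChartAt 𝓘(ℝ, E) c).symm e) (X ((extChartAt 𝓘(ℝ, E) c).symm e)) =
      chartDeriv c e (christoffel c cov X e v) := by
  have htorsion := hcov.torsion_free (coordField c v) X _ (mdifferentiableAt_coordField c he v) hX
  rw [coordField_extChartAt_symm c he, ← chartDeriv_fderiv_fieldInChart c he hX] at htorsion
  rw [chartDeriv_christoffel c he, ← htorsion, sub_sub_cancel]

theorem fderiv_chartMetric (v w : E) :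
    fderiv ℝ (fun z ↦ chartMetric g c z v w) e (fieldInChart c X e) =
      chartMetric g c e (christoffel c cov X e v) w +
        chartMetric g c e v (christoffel c cov X e w) := by
  have hv := mdifferentiableAt_coordField c he v
  have hw := mdifferentiableAt_coordField c he w
  have hx := (extChartAt 𝓘(ℝ, E) c).map_target he
  have hinner : MDiffAt (fun x ↦ g.inner x (coordField c v x) (coordField c w x))
      ((extChartAt 𝓘(ℝ, E) c).symm e) :=
    (contMDiffAt_inner g (contMDiffAt_coordField c hx v)
      (contMDiffAt_coordField c hx w)).mdifferentiableAt (by simp)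
  rw [(chartMetric_eventuallyEq g c he v w).fderiv_eq,
    fderiv_comp_extChartAt_symm_fieldInChart c he hinner, hcov.metric_compatible _ _ _ hv hw,
    cov_coordField c hcov he hX, cov_coordField c hcov he hX, coordField_extChartAt_symm c he,
    coordField_extChartAt_symm c he]
  rfl

variable [FiniteDimensional ℝ E]

theorem fderiv_det_gram :
    fderiv ℝ (fun z ↦ (gram g c z).det) e (fieldInChart c X e) =
      2 * (gram g c e).det * LinearMap.trace ℝ E (christoffel c cov X e) := by
  let b := Module.finBasis ℝ E
  let N := LinearMap.toMatrix b b (christoffel c cov X e)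
  have hgram : (Matrix.of fun i j ↦ fderiv ℝ (fun z ↦ gram g c z i j) e (fieldInChart c X e)) =
      N.transpose * gram g c e + gram g c e * N := by
    rw [gram, ← LinearMap.BilinForm.toMatrix_compLeft, ← LinearMap.BilinForm.toMatrix_compRight]
    ext i j
    simp only [Matrix.of_apply, gram_apply, fderiv_chartMetric c hcov he hX, Matrix.add_apply,
      LinearMap.BilinForm.toMatrix_apply, LinearMap.BilinForm.compLeft_apply,
      LinearMap.BilinForm.compRight_apply, b]
  rw [fderiv_det_apply (fun i j ↦ (contDiffAt_gram g c he i j).differentiableAt (by simp)), hgram,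
    trace_adjugate_mul_transpose_mul_add_mul, LinearMap.trace_eq_matrix_trace ℝ b]

theorem fderiv_density :
    fderiv ℝ (density g c) e (fieldInChart c X e) =
      density g c e * LinearMap.trace ℝ E (christoffel c cov X e) := by
  have hdet := det_gram_pos g c he
  have hsqrt := ((contDiffAt_det_gram g c he).differentiableAt (by simp)).hasFDerivAt.sqrt hdet.ne'
  have hsq : (gram g c e).det = density g c e * density g c e :=
    (Real.mul_self_sqrt hdet.le).symm
  have hpos := density_pos g c he
  have hchain : fderiv ℝ (density g c) e (fieldInChart c X e) = 1 / (2 * density g c e) *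
      fderiv ℝ (fun z ↦ (gram g c z).det) e (fieldInChart c X e) :=
    DFunLike.congr_fun hsqrt.fderiv _
  rw [hchain, fderiv_det_gram c hcov he hX, hsq]
  field_simp

theorem trace_fderiv_density_smul_fieldInChart :
    LinearMap.trace ℝ E (fderiv ℝ (density g c • fieldInChart c X) e).toLinearMap =
      density g c e * divergence cov X ((extChartAt 𝓘(ℝ, E) c).symm e) := by
  have hd := (contDiffAt_density g c he).differentiableAt (by simp)
  rw [trace_fderiv_smul hd (differentiableAt_fieldInChart c he hX),
    fderiv_density c hcov he hX, trace_christoffel c he]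
  ring

end Density

section Transition

variable {E : Type*} [NormedAddCommGroup E] [NormedSpace ℝ E]
  {M : Type*} [TopologicalSpace M] [ChartedSpace E M]

/-- The change of coordinates from the chart at `c` to the chart at `d`. -/
def transition (c d : M) : PartialEquiv E E :=
  (extChartAt 𝓘(ℝ, E) c).symm.trans (extChartAt 𝓘(ℝ, E) d)

variable {c d : M} {e : E}

theorem isOpen_transition_source : IsOpen (transition (E := E) c d).source :=
  (continuousOn_extChartAt_symm c).isOpen_inter_preimage (isOpen_extChartAt_target c)
    (isOpen_extChartAt_source d)

variable [IsManifold 𝓘(ℝ, E) ∞ M] (g : RiemMetric E M)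

theorem differentiableAt_transition (he : e ∈ (transition c d).source) :
    DifferentiableAt ℝ (transition c d) e :=
  (contMDiffAt_iff_contDiffAt.1 ((contMDiffAt_extChartAt' (n := ∞) (by simpa using he.2)).comp e
    (contMDiffAt_extChartAt_symm c he.1))).differentiableAt (by simp)

theorem chartDeriv_transition (he : e ∈ (transition c d).source) (v : E) :
    (chartDeriv c e v : E) =
      (chartDeriv d (transition c d e) (fderiv ℝ (transition c d) e v) : E) := by
  have hinv : (extChartAt 𝓘(ℝ, E) c).symm =ᶠ[𝓝 e]
      (extChartAt 𝓘(ℝ, E) d).symm ∘ transition c d := by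
    filter_upwards [isOpen_transition_source.mem_nhds he] with z hz
    exact ((extChartAt 𝓘(ℝ, E) d).left_inv hz.2).symm
  have hcomp := ((contMDiffAt_extChartAt_symm d ((extChartAt 𝓘(ℝ, E) d).map_source
    he.2)).mdifferentiableAt (by simp)).hasMFDerivAt.comp e
      (differentiableAt_transition he).hasFDerivAt.hasMFDerivAt
  exact DFunLike.congr_fun (hcomp.congr_of_eventuallyEq hinv).mfderiv v

theorem chartMetric_transition (he : e ∈ (transition c d).source) :
    chartMetric g c e = (chartMetric g d (transition c d e)).comp
      (fderiv ℝ (transition c d) e).toLinearMap (fderiv ℝ (transition c d) e).toLinearMap := by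
  have hpoint : (extChartAt 𝓘(ℝ, E) d).symm (transition c d e) = (extChartAt 𝓘(ℝ, E) c).symm e :=
    (extChartAt 𝓘(ℝ, E) d).left_inv he.2
  have hinner {x y : M} (h : x = y) (v w : E) :
      g.inner x (show TangentSpace 𝓘(ℝ, E) x from v) (show TangentSpace 𝓘(ℝ, E) x from w) =
        g.inner y (show TangentSpace 𝓘(ℝ, E) y from v) (show TangentSpace 𝓘(ℝ, E) y from w) := by
    subst h
    rfl
  ext v w
  refine (hinner hpoint.symm (chartDeriv c e v) (chartDeriv c e w)).trans ?_
  rw [chartDeriv_transition he v, chartDeriv_transition he w]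
  rfl

theorem density_transition [FiniteDimensional ℝ E] (he : e ∈ (transition c d).source) :
    density g c e = |(fderiv ℝ (transition c d) e).det| * density g d (transition c d e) := by
  rw [density, gram, chartMetric_transition g he,
    LinearMap.BilinForm.toMatrix_comp (Module.finBasis ℝ E), Matrix.det_mul, Matrix.det_mul,
    Matrix.det_transpose, LinearMap.det_toMatrix, mul_right_comm,
    Real.sqrt_mul (mul_self_nonneg _), Real.sqrt_mul_self_eq_abs]
  rfl

end Transition

/-! ### The divergence theorem -/

section IntegralTrace

open MeasureTheory

variable {E : Type*} [NormedAddCommGroup E] [NormedSpace ℝ E] [FiniteDimensional ℝ E]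
  [MeasurableSpace E] [BorelSpace E] (μ : Measure E) [μ.IsAddHaarMeasure]

theorem integral_fderiv_apply_eq_zero {f : E → ℝ} (hf : ContDiff ℝ 1 f)
    (hf' : HasCompactSupport f) (v : E) : ∫ e, fderiv ℝ f e v ∂μ = 0 := by
  have hderiv : Integrable (fun e ↦ fderiv ℝ f e v) μ :=
    ((hf.continuous_fderiv one_ne_zero).clm_apply
      continuous_const).integrable_of_hasCompactSupport (hf'.fderiv_apply ℝ v)
  have hparts := integral_mul_fderiv_eq_neg_fderiv_mul_of_integrable (μ := μ) (f := fun _ ↦ 1)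
    (g := f) (v := v) (by simp) (by simpa using hderiv)
    (by simpa using hf.continuous.integrable_of_hasCompactSupport hf')
    (fun _ _ ↦ differentiableAt_const _) fun _ _ ↦ hf.differentiable one_ne_zero _
  simpa using hparts

theorem integral_trace_fderiv_eq_zero {X : E → E} (hX : ContDiff ℝ 1 X)
    (hX' : HasCompactSupport X) :
    ∫ e, LinearMap.trace ℝ E (fderiv ℝ X e).toLinearMap ∂μ = 0 := by
  let b := Module.finBasis ℝ E
  let coord i := (b.coord i).toContinuousLinearMap
  have hsmooth i : ContDiff ℝ 1 (coord i ∘ X) := (coord i).contDiff.comp hX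
  have hcompact i : HasCompactSupport (coord i ∘ X) := hX'.comp_left (map_zero _)
  have htrace e : LinearMap.trace ℝ E (fderiv ℝ X e).toLinearMap =
      ∑ i, fderiv ℝ (coord i ∘ X) e (b i) := by
    rw [LinearMap.trace_eq_matrix_trace ℝ b]
    refine Finset.sum_congr rfl fun i _ ↦ ?_
    rw [fderiv_comp e (coord i).differentiableAt (hX.differentiable one_ne_zero e),
      ContinuousLinearMap.fderiv, Matrix.diag_apply, LinearMap.toMatrix_apply]
    rfl
  simp only [htrace]
  rw [integral_finsetSum _ fun i _ ↦ (((hsmooth i).continuous_fderiv one_ne_zero).clm_apply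
    continuous_const).integrable_of_hasCompactSupport ((hcompact i).fderiv_apply ℝ _)]
  exact Finset.sum_eq_zero fun i _ ↦ integral_fderiv_apply_eq_zero μ (hsmooth i) (hcompact i) _

end IntegralTrace

section ExtendByZero

variable {E : Type*} [NormedAddCommGroup E] [NormedSpace ℝ E]
  {M : Type*} [TopologicalSpace M] [ChartedSpace E M]
  {F : Type*} [NormedAddCommGroup F] [NormedSpace ℝ F] {c : M} {h : M → ℝ} {u : E → F} {e : E}

/-- The product of `u` and of the expression of `h` in the chart at `c`, extended by zero to the
model space. -/
def extendByZero (c : M) (h : M → ℝ) (u : E → F) : E → F :=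
  (extChartAt 𝓘(ℝ, E) c).target.indicator ((h ∘ (extChartAt 𝓘(ℝ, E) c).symm) • u)

theorem extendByZero_of_mem (he : e ∈ (extChartAt 𝓘(ℝ, E) c).target) :
    extendByZero c h u e = h ((extChartAt 𝓘(ℝ, E) c).symm e) • u e :=
  indicator_of_mem he _

theorem extendByZero_eventuallyEq (he : e ∈ (extChartAt 𝓘(ℝ, E) c).target) :
    extendByZero c h u =ᶠ[𝓝 e] (h ∘ (extChartAt 𝓘(ℝ, E) c).symm) • u := by
  filter_upwards [extChartAt_target_mem_nhds_of_mem c he] with z hz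
  exact extendByZero_of_mem hz

theorem extendByZero_nonneg {u : E → ℝ} (hh : ∀ x, 0 ≤ h x) (hu : ∀ e, 0 ≤ u e) :
    0 ≤ extendByZero c h u :=
  indicator_nonneg fun _ _ ↦ mul_nonneg (hh _) (hu _)

theorem extendByZero_add (c : M) (h k : M → ℝ) (u : E → F) :
    extendByZero c (h + k) u = extendByZero c h u + extendByZero c k u := by
  rw [extendByZero, extendByZero, extendByZero, ← indicator_add', ← add_smul]
  rfl

theorem extendByZero_smul (c : M) (r : ℝ) (h : M → ℝ) (u : E → F) :
    extendByZero c (r • h) u = r • extendByZero c h u := by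
  rw [extendByZero, Pi.smul_comp, smul_assoc]
  exact indicator_const_smul _ _ _

theorem support_extendByZero_subset :
    Function.support (extendByZero c h u) ⊆ extChartAt 𝓘(ℝ, E) c '' tsupport h := by
  intro e he
  have htarget : e ∈ (extChartAt 𝓘(ℝ, E) c).target :=
    not_not.1 fun hn ↦ he (indicator_of_notMem hn _)
  rw [Function.mem_support, extendByZero_of_mem htarget] at he
  exact ⟨_, subset_tsupport h (left_ne_zero_of_smul he),
    (extChartAt 𝓘(ℝ, E) c).right_inv htarget⟩

variable [CompactSpace M] (hs : tsupport h ⊆ (extChartAt 𝓘(ℝ, E) c).source)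
include hs

theorem isCompact_extChartAt_image_tsupport : IsCompact (extChartAt 𝓘(ℝ, E) c '' tsupport h) :=
  (isClosed_tsupport h).isCompact.image_of_continuousOn ((continuousOn_extChartAt c).mono hs)

theorem hasCompactSupport_extendByZero : HasCompactSupport (extendByZero c h u) :=
  .of_support_subset_isCompact (isCompact_extChartAt_image_tsupport hs)
    support_extendByZero_subset

theorem extendByZero_eventuallyEq_zero (he : e ∉ (extChartAt 𝓘(ℝ, E) c).target) :
    extendByZero c h u =ᶠ[𝓝 e] 0 := by
  refine notMem_tsupport_iff_eventuallyEq.1 fun hmem ↦ he ?_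
  obtain ⟨x, hx, rfl⟩ := closure_minimal support_extendByZero_subset
    (isCompact_extChartAt_image_tsupport hs).isClosed hmem
  exact (extChartAt 𝓘(ℝ, E) c).map_source (hs hx)

theorem contDiff_extendByZero [IsManifold 𝓘(ℝ, E) ∞ M] (hh : CMDiff ∞ h)
    (hu : ∀ e ∈ (extChartAt 𝓘(ℝ, E) c).target, ContDiffAt ℝ ∞ u e) :
    ContDiff ℝ ∞ (extendByZero c h u) := by
  refine contDiff_iff_contDiffAt.2 fun e ↦ ?_
  by_cases he : e ∈ (extChartAt 𝓘(ℝ, E) c).target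
  · exact ((contDiffAt_comp_extChartAt_symm c he hh.contMDiffAt).smul
      (hu e he)).congr_of_eventuallyEq (extendByZero_eventuallyEq he)
  · exact contDiffAt_const.congr_of_eventuallyEq (extendByZero_eventuallyEq_zero hs he)

end ExtendByZero

section ChartIntegral

open MeasureTheory

variable {E : Type*} [NormedAddCommGroup E] [NormedSpace ℝ E] [FiniteDimensional ℝ E]
  [MeasurableSpace E] {M : Type*} [TopologicalSpace M] [ChartedSpace E M]
  [IsManifold 𝓘(ℝ, E) ∞ M] (μ : Measure E) (g : RiemMetric E M) {c : M} {h : M → ℝ}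

/-- The Riemannian integral of a function supported in the domain of the chart at `c`. -/
def chartIntegral (c : M) (h : M → ℝ) : ℝ := ∫ e, extendByZero c h (density g c) e ∂μ

theorem chartIntegral_nonneg (hh : ∀ x, 0 ≤ h x) : 0 ≤ chartIntegral μ g c h :=
  integral_nonneg (extendByZero_nonneg hh fun _ ↦ Real.sqrt_nonneg _)

variable [BorelSpace E]

theorem chartIntegral_eq_setIntegral (d : M)
    (hd : ∀ x ∉ (extChartAt 𝓘(ℝ, E) d).source, h x = 0) : chartIntegral μ g c h =
      ∫ e in (transition c d).source, h ((extChartAt 𝓘(ℝ, E) c).symm e) • density g c e ∂μ := by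
  have hmeas : MeasurableSet (extChartAt 𝓘(ℝ, E) c).target :=
    (isOpen_extChartAt_target c).measurableSet
  refine (integral_indicator hmeas).trans <|
    setIntegral_eq_of_subset_of_forall_sdiff_eq_zero hmeas inter_subset_left fun e he ↦ ?_
  have hzero : h ((extChartAt 𝓘(ℝ, E) c).symm e) = 0 := hd _ fun hsource ↦ he.2 ⟨he.1, hsource⟩
  exact (congrArg (· • _) hzero).trans (zero_smul ℝ _)

theorem chartIntegral_eq_of_support [μ.IsAddHaarMeasure] {d : M}
    (hc : ∀ x ∉ (extChartAt 𝓘(ℝ, E) c).source, h x = 0)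
    (hd : ∀ x ∉ (extChartAt 𝓘(ℝ, E) d).source, h x = 0) :
    chartIntegral μ g c h = chartIntegral μ g d h := by
  rw [chartIntegral_eq_setIntegral μ g d hd, chartIntegral_eq_setIntegral μ g c hc,
    show (transition d c).source = transition c d '' (transition c d).source from
      ((transition c d).image_source_eq_target).symm,
    integral_image_eq_integral_abs_det_fderiv_smul μ isOpen_transition_source.measurableSet
      (fun e he ↦ (differentiableAt_transition he).hasFDerivAt.hasFDerivWithinAt)
      (transition c d).injOn]
  refine setIntegral_congr_fun isOpen_transition_source.measurableSet fun e he ↦ ?_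
  have hpoint : (extChartAt 𝓘(ℝ, E) d).symm (transition c d e) = (extChartAt 𝓘(ℝ, E) c).symm e :=
    (extChartAt 𝓘(ℝ, E) d).left_inv he.2
  simp only [smul_eq_mul]
  rw [hpoint, density_transition g he]
  ring

variable [CompactSpace M] (hs : tsupport h ⊆ (extChartAt 𝓘(ℝ, E) c).source)
include hs

theorem integrable_extendByZero_density [IsFiniteMeasureOnCompacts μ] (hh : CMDiff ∞ h) :
    Integrable (extendByZero c h (density g c)) μ :=
  (contDiff_extendByZero hs hh fun _ ↦
    contDiffAt_density g c).continuous.integrable_of_hasCompactSupport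
      (hasCompactSupport_extendByZero hs)

theorem chartIntegral_pos [μ.IsAddHaarMeasure] (hh : CMDiff ∞ h) (hnonneg : ∀ x, 0 ≤ h x) {x : M}
    (hx : h x ≠ 0) : 0 < chartIntegral μ g c h := by
  have hsource : x ∈ (extChartAt 𝓘(ℝ, E) c).source := hs (subset_tsupport h hx)
  have htarget := (extChartAt 𝓘(ℝ, E) c).map_source hsource
  refine (contDiff_extendByZero hs hh fun _ ↦
    contDiffAt_density g c).continuous.integral_pos_of_hasCompactSupport_nonneg_nonzero
    (x := extChartAt 𝓘(ℝ, E) c x) (hasCompactSupport_extendByZero hs)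
    (extendByZero_nonneg hnonneg fun _ ↦ Real.sqrt_nonneg _) ?_
  rw [extendByZero_of_mem htarget, (extChartAt 𝓘(ℝ, E) c).left_inv hsource]
  exact mul_ne_zero hx (density_pos g c htarget).ne'

theorem chartIntegral_mvfderiv_eq_zero [μ.IsAddHaarMeasure] {cov : Connection E M}
    (hcov : IsLeviCivita g cov) (X : VectorFields E M) (hdiv : ∀ x, divergence cov X x = 0)
    (hh : CMDiff ∞ h) : chartIntegral μ g c (fun x ↦ mvfderiv 𝓘(ℝ, E) h x (X x)) = 0 := by
  let flux : E → E := density g c • fieldInChart c X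
  have hflux (e) (he : e ∈ (extChartAt 𝓘(ℝ, E) c).target) : ContDiffAt ℝ ∞ flux e :=
    (contDiffAt_density g c he).smul (contDiffAt_fieldInChart c he X.contMDiff.contMDiffAt)
  have hpoint (e : E) : extendByZero c (fun x ↦ mvfderiv 𝓘(ℝ, E) h x (X x)) (density g c) e =
      LinearMap.trace ℝ E (fderiv ℝ (extendByZero c h flux) e).toLinearMap := by
    by_cases he : e ∈ (extChartAt 𝓘(ℝ, E) c).target
    · rw [(extendByZero_eventuallyEq he).fderiv_eq, trace_fderiv_smul
        ((contDiffAt_comp_extChartAt_symm c he hh.contMDiffAt).differentiableAt (by simp))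
        ((hflux e he).differentiableAt (by simp)),
        trace_fderiv_density_smul_fieldInChart c hcov he
          (X.contMDiff.mdifferentiableAt (by simp)), hdiv, extendByZero_of_mem he,
        ← fderiv_comp_extChartAt_symm_fieldInChart c he (hh.mdifferentiableAt (by simp)) X]
      simp [flux, mul_comm]
    · have hzero := extendByZero_eventuallyEq_zero (u := flux) hs he
      rw [hzero.fderiv_eq, extendByZero, indicator_of_notMem he]
      simp
  rw [chartIntegral, integral_congr_ae (Eventually.of_forall hpoint)]
  exact integral_trace_fderiv_eq_zero μ ((contDiff_extendByZero hs hh hflux).of_le (by simp))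
    (hasCompactSupport_extendByZero hs)

end ChartIntegral

section LieDerivative

variable {E : Type*} [NormedAddCommGroup E] [NormedSpace ℝ E]
  {M : Type*} [TopologicalSpace M] [ChartedSpace E M]

theorem tsupport_mvfderiv_apply_subset (f : M → ℝ) (X : (x : M) → TangentSpace 𝓘(ℝ, E) x) :
    tsupport (fun x ↦ mvfderiv 𝓘(ℝ, E) f x (X x)) ⊆ tsupport f := by
  refine closure_minimal (fun x hx ↦ ?_) (isClosed_tsupport f)
  contrapose! hx
  have hconst : HasMFDerivAt 𝓘(ℝ, E) 𝓘(ℝ, ℝ) f x 0 :=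
    (hasMFDerivAt_const (0 : ℝ) x).congr_of_eventuallyEq (notMem_tsupport_iff_eventuallyEq.1 hx)
  exact Function.notMem_support.2 (DFunLike.congr_fun hconst.mfderiv (X x))

variable [IsManifold 𝓘(ℝ, E) ∞ M]

/-- The derivative `f ↦ X f` of functions along the vector field `X`. -/
def lieDeriv (X : VectorFields E M) : ScalarFields E M →ₗ[ℝ] ScalarFields E M where
  toFun f := ⟨fun x ↦ mvfderiv 𝓘(ℝ, E) f x (X x), contMDiff_mvfderiv_apply f.contMDiff X.contMDiff⟩
  map_add' f h := by
    ext x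
    exact DFunLike.congr_fun (mvfderiv_add (f.contMDiff.mdifferentiable (by simp) x)
      (h.contMDiff.mdifferentiable (by simp) x)) (X x)
  map_smul' r f := by
    ext x
    refine (DFunLike.congr_fun (mvfderiv_smul (a := fun _ ↦ r) mdifferentiableAt_const
      (f.contMDiff.mdifferentiable (by simp) x)) (X x)).trans ?_
    rw [mvfderiv_const]
    simp
    rfl

/-- The pointwise inner product of vector fields, as a function on the manifold. -/
def innerField (g : RiemMetric E M) :
    VectorFields E M →ₗ[ℝ] VectorFields E M →ₗ[ℝ] ScalarFields E M :=
  LinearMap.mk₂ ℝ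
    (fun X Y ↦ ⟨fun x ↦ g.inner x (X x) (Y x), fun _ ↦
      contMDiffAt_inner g X.contMDiff.contMDiffAt Y.contMDiff.contMDiffAt⟩)
    (fun X X' Y ↦ ContMDiffMap.ext fun x ↦
      DFunLike.congr_fun (map_add (g.inner x) (X x) (X' x)) (Y x))
    (fun r X Y ↦ ContMDiffMap.ext fun x ↦
      DFunLike.congr_fun (map_smul (g.inner x) r (X x)) (Y x))
    (fun X Y Y' ↦ ContMDiffMap.ext fun x ↦ map_add (g.inner x (X x)) (Y x) (Y' x))
    (fun r X Y ↦ ContMDiffMap.ext fun x ↦ map_smul (g.inner x (X x)) r (Y x))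

theorem innerField_apply (g : RiemMetric E M) (X Y : VectorFields E M) (x : M) :
    innerField g X Y x = g.inner x (X x) (Y x) := rfl

theorem lieDeriv_innerField_self {g : RiemMetric E M} {cov : Connection E M}
    (hcov : IsLeviCivita g cov) (X : VectorFields E M) (x : M) :
    lieDeriv X (innerField g X X) x = 2 * g.inner x (cov X x (X x)) (X x) := by
  have hX : MDiffAt (T% (X : (x : M) → TangentSpace 𝓘(ℝ, E) x)) x :=
    X.contMDiff.mdifferentiableAt (by simp)
  refine (hcov.metric_compatible X X x hX hX (X x)).trans ?_
  rw [g.symm x (X x), two_mul]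

theorem innerField_eq_of_euler [FiniteDimensional ℝ E] {g : RiemMetric E M} {cov : Connection E M}
    (hcov : IsLeviCivita g cov) {X W : VectorFields E M} {p : ScalarFields E M}
    (heuler : ∀ x, W x + cov X x (X x) = -gradient g p x) :
    innerField g W X = -(1 / 2 : ℝ) • lieDeriv X (innerField g X X) - lieDeriv X p := by
  ext x
  have henergy := lieDeriv_innerField_self hcov X x
  have hpressure : lieDeriv X p x = g.inner x (gradient g p x) (X x) :=
    (inner_gradient g p x (X x)).symm
  have hpower : innerField g W X x =
      -g.inner x (gradient g p x) (X x) - g.inner x (cov X x (X x)) (X x) := by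
    rw [innerField_apply, eq_sub_of_add_eq (heuler x), map_sub, map_neg]
    rfl
  rw [hpower, ContMDiffMap.coe_sub, Pi.sub_apply, ContMDiffMap.coe_smul, Pi.smul_apply,
    smul_eq_mul, henergy, hpressure]
  ring

end LieDerivative

section RiemannianIntegral

open MeasureTheory

variable {E : Type*} [NormedAddCommGroup E] [NormedSpace ℝ E]
  {M : Type*} [TopologicalSpace M] [ChartedSpace E M]

theorem tsupport_mul_subset {φ : ScalarFields E M} {s : Set M} (hφ : tsupport φ ⊆ s)
    (f : ScalarFields E M) : tsupport (φ * f : ScalarFields E M) ⊆ s :=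
  (tsupport_mul_subset_left (f := φ) (g := f)).trans hφ

variable (E M) in
/-- A finite smooth partition of unity subordinate to the domains of the charts. -/
structure ChartPartition where
  index : Finset M
  weight : M → ScalarFields E M
  tsupport_subset (i : M) : tsupport (weight i) ⊆ (extChartAt 𝓘(ℝ, E) i).source
  nonneg (i x : M) : 0 ≤ weight i x
  sum_eq_one : ∑ i ∈ index, weight i = 1

theorem ChartPartition.exists_weight_ne_zero (ρ : ChartPartition E M) (x : M) :
    ∃ i ∈ ρ.index, ρ.weight i x ≠ 0 := by
  by_contra! hzero
  have hsum : ∑ i ∈ ρ.index, ρ.weight i x = 1 :=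
    (map_sum (ContMDiffMap.evalRingHom x) _ _).symm.trans
      (congrArg (fun f : ScalarFields E M ↦ f x) ρ.sum_eq_one)
  rw [Finset.sum_eq_zero hzero] at hsum
  exact zero_ne_one hsum

theorem nonempty_chartPartition [FiniteDimensional ℝ E] [IsManifold 𝓘(ℝ, E) ∞ M] [CompactSpace M]
    [T2Space M] : Nonempty (ChartPartition E M) := by
  obtain ⟨ρ, hρ⟩ := SmoothPartitionOfUnity.exists_isSubordinate_chartAt_source 𝓘(ℝ, E) M
  have hfin := ρ.locallyFinite.finite_nonempty_of_compact
  refine ⟨⟨hfin.toFinset, fun i ↦ ρ i, fun i ↦ ?_, fun i x ↦ ρ.nonneg i x, ?_⟩⟩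
  · rw [extChartAt_source]
    exact hρ i
  · ext x
    refine (map_sum (ContMDiffMap.evalRingHom x) _ _).trans ?_
    refine (finsum_eq_sum_of_support_subset _ fun i hi ↦ ?_).symm.trans
      (ρ.sum_eq_one (mem_univ x))
    rw [Set.Finite.coe_toFinset]
    exact ⟨x, hi⟩

variable [FiniteDimensional ℝ E] [IsManifold 𝓘(ℝ, E) ∞ M] [CompactSpace M]
  [MeasurableSpace E] [BorelSpace E] (μ : Measure E) (g : RiemMetric E M)

/-- The integral of `φ f` as a linear function of `f`, for a cutoff function `φ` supported in the
domain of the chart at `c`. -/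
def cutoffIntegral [IsFiniteMeasureOnCompacts μ] {c : M} (φ : ScalarFields E M)
    (hφ : tsupport φ ⊆ (extChartAt 𝓘(ℝ, E) c).source) : ScalarFields E M →ₗ[ℝ] ℝ where
  toFun f := chartIntegral μ g c (φ * f : ScalarFields E M)
  map_add' f h := by
    rw [mul_add, chartIntegral, ContMDiffMap.coe_add, extendByZero_add]
    exact integral_add
      (integrable_extendByZero_density μ g (tsupport_mul_subset hφ f) (φ * f).contMDiff)
      (integrable_extendByZero_density μ g (tsupport_mul_subset hφ h) (φ * h).contMDiff)
  map_smul' r f := by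
    rw [mul_smul_comm, chartIntegral, ContMDiffMap.coe_smul, extendByZero_smul]
    exact integral_smul r _

/-- The integral against the Riemannian measure, computed with a partition of unity. -/
def riemannianIntegral [IsFiniteMeasureOnCompacts μ] (ρ : ChartPartition E M) :
    ScalarFields E M →ₗ[ℝ] ℝ :=
  ∑ i ∈ ρ.index, cutoffIntegral μ g (ρ.weight i) (ρ.tsupport_subset i)

variable [μ.IsAddHaarMeasure] (ρ : ChartPartition E M)

theorem riemannianIntegral_apply (f : ScalarFields E M) : riemannianIntegral μ g ρ f =
    ∑ i ∈ ρ.index, chartIntegral μ g i (ρ.weight i * f : ScalarFields E M) :=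
  LinearMap.sum_apply _ _ _

theorem riemannianIntegral_pos {f : ScalarFields E M} (hf : ∀ x, 0 ≤ f x) {x : M}
    (hx : f x ≠ 0) : 0 < riemannianIntegral μ g ρ f := by
  have hnonneg (i x : M) : 0 ≤ (ρ.weight i * f : ScalarFields E M) x :=
    mul_nonneg (ρ.nonneg i x) (hf x)
  obtain ⟨i, hi, hix⟩ := ρ.exists_weight_ne_zero x
  rw [riemannianIntegral_apply]
  exact Finset.sum_pos' (fun j _ ↦ chartIntegral_nonneg μ g (hnonneg j)) ⟨i, hi,
    chartIntegral_pos μ g (tsupport_mul_subset (ρ.tsupport_subset i) f)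
      (ρ.weight i * f).contMDiff (hnonneg i) (mul_ne_zero hix hx)⟩

theorem riemannianIntegral_eq_chartIntegral {f : ScalarFields E M} {c : M}
    (hf : tsupport f ⊆ (extChartAt 𝓘(ℝ, E) c).source) :
    riemannianIntegral μ g ρ f = chartIntegral μ g c f := by
  have hchart (i : M) : chartIntegral μ g i (ρ.weight i * f : ScalarFields E M) =
      cutoffIntegral μ g f hf (ρ.weight i) := by
    rw [mul_comm]
    refine chartIntegral_eq_of_support μ g (fun x hx ↦ ?_) fun x hx ↦ ?_
    · refine mul_eq_zero_of_right _ (image_eq_zero_of_notMem_tsupport fun hmem ↦ hx ?_)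
      exact ρ.tsupport_subset i hmem
    · exact mul_eq_zero_of_left (image_eq_zero_of_notMem_tsupport fun hmem ↦ hx (hf hmem)) _
  rw [riemannianIntegral_apply, Finset.sum_congr rfl fun i _ ↦ hchart i, ← map_sum, ρ.sum_eq_one]
  exact congrArg (fun f : ScalarFields E M ↦ chartIntegral μ g c f) (mul_one f)

theorem riemannianIntegral_lieDeriv_eq_zero {cov : Connection E M} (hcov : IsLeviCivita g cov)
    {X : VectorFields E M} (hdiv : ∀ x, divergence cov X x = 0) (f : ScalarFields E M) :
    riemannianIntegral μ g ρ (lieDeriv X f) = 0 := by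
  rw [← one_mul f, ← ρ.sum_eq_one, Finset.sum_mul, map_sum, map_sum]
  refine Finset.sum_eq_zero fun i _ ↦ ?_
  have hs := tsupport_mul_subset (ρ.tsupport_subset i) f
  rw [riemannianIntegral_eq_chartIntegral μ g ρ
    ((tsupport_mvfderiv_apply_subset _ X).trans hs)]
  exact chartIntegral_mvfderiv_eq_zero μ g hs hcov X hdiv (ρ.weight i * f).contMDiff

end RiemannianIntegral

section Conservation

variable {V : Type*} [NormedAddCommGroup V] [NormedSpace ℝ V] [FiniteDimensional ℝ V]

theorem exists_solvesODEOn (B : V →ₗ[ℝ] V →ₗ[ℝ] V) (y₀ : V) :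
    ∃ (y : ℝ → V) (J : Set ℝ), IsTimeInterval J ∧ J ∈ 𝓝 0 ∧ y 0 = y₀ ∧ SolvesODEOn B y J := by
  let B' : V →L[ℝ] V →L[ℝ] V :=
    (LinearMap.toContinuousLinearMap.toLinearMap ∘ₗ B).toContinuousLinearMap
  have hB : ContDiff ℝ 1 fun y ↦ B y y := B'.contDiff.clm_apply contDiff_id
  obtain ⟨y, hy0, ε, hε, hy⟩ :=
    hB.contDiffAt.exists_forall_mem_closedBall_exists_eq_forall_mem_Ioo_hasDerivAt₀ (x₀ := y₀) 0
  rw [zero_sub, zero_add] at hy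
  have hnhds : Ioo (-ε) ε ∈ 𝓝 0 := Ioo_mem_nhds (by linarith) hε
  have hnontrivial : (Ioo (-ε) ε).Nontrivial :=
    (infinite_of_mem_nhds 0 hnhds).nontrivial
  exact ⟨y, Ioo (-ε) ε, ⟨ordConnected_Ioo, hnontrivial⟩, hnhds, hy0,
    fun t ht ↦ (hy t ht).hasDerivWithinAt⟩

variable {B : V →ₗ[ℝ] V →ₗ[ℝ] V} {N : CompactRiemannianManifold} {cov : Connection N.E N.M}
  {U : V →ₗ[ℝ] VectorFields N.E N.M} {P : V → ScalarFields N.E N.M}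

theorem euler_at_of_forall_solvesODEOn
    (h : ∀ (J : Set ℝ) (y : ℝ → V), IsTimeInterval J → SolvesODEOn B y J →
      SolvesEulerOn N cov (fun t ↦ U (y t)) (fun t ↦ P (y t)) J) (y : V) (x : N.M) :
    U (B y y) x + cov (U y) x (U y x) = -gradient N.g (P y) x ∧ divergence cov (U y) x = 0 := by
  obtain ⟨z, J, hJ, hJ0, rfl, hz⟩ := exists_solvesODEOn B y
  obtain ⟨⟨w, hw, heq⟩, hdiv⟩ := h J z hJ hz 0 (mem_of_mem_nhds hJ0) x
  refine ⟨?_, hdiv⟩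
  let L : V →ₗ[ℝ] N.E :=
    { toFun := fun y ↦ U y x
      map_add' := fun y z ↦ by rw [map_add]; rfl
      map_smul' := fun r y ↦ by rw [map_smul]; rfl }
  have hUz : HasDerivAt (fun s ↦ L (z s)) (L (B (z 0) (z 0))) 0 :=
    L.toContinuousLinearMap.hasFDerivAt.comp_hasDerivAt 0
      ((hz 0 (mem_of_mem_nhds hJ0)).hasDerivAt hJ0)
  have hw' : HasDerivAt (fun s ↦ L (z s)) w 0 := HasDerivWithinAt.hasDerivAt hw hJ0
  rw [hw'.unique hUz] at heq
  exact heq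

theorem exists_conserved_of_embedsIntoEuler (h : EmbedsIntoEuler B N) :
    ∃ Q : LinearMap.BilinForm ℝ V, (∀ y z, Q y z = Q z y) ∧ (∀ y, y ≠ 0 → 0 < Q y y) ∧
      ∀ y, Q (B y y) y = 0 := by
  obtain ⟨cov, hcov, U, P, hU, hsol⟩ := h
  let _ : MeasurableSpace N.E := borel N.E
  have : BorelSpace N.E := ⟨rfl⟩
  obtain ⟨ρ⟩ := nonempty_chartPartition (E := N.E) (M := N.M)
  let integral := riemannianIntegral MeasureTheory.Measure.addHaar N.g ρ
  refine ⟨((innerField N.g).compr₂ integral).compl₁₂ U U, fun y z ↦ ?_, fun y hy ↦ ?_,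
    fun y ↦ ?_⟩
  · exact congrArg integral (ContMDiffMap.ext fun x ↦ N.g.symm x _ _)
  · obtain ⟨x, hx⟩ : ∃ x, U y x ≠ 0 := by
      by_contra! hzero
      exact hy (hU ((ContMDiffSection.ext hzero).trans (map_zero U).symm))
    refine riemannianIntegral_pos _ N.g ρ (fun z ↦ ?_) (N.g.pos x _ hx).ne'
    by_cases hz : U y z = 0
    · rw [innerField_apply, hz, map_zero]
    · exact (N.g.pos z _ hz).le
  · have heuler := euler_at_of_forall_solvesODEOn hsol y
    have hzero := riemannianIntegral_lieDeriv_eq_zero MeasureTheory.Measure.addHaar N.g ρ hcov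
      fun x ↦ (heuler x).2
    refine (congrArg integral (innerField_eq_of_euler hcov fun x ↦ (heuler x).1)).trans ?_
    rw [map_sub, map_smul, hzero, hzero, smul_zero, sub_zero]

end Conservation

/-! ### Lie framings and the Euler-Arnold equation -/

section Sections

variable {E : Type*} [NormedAddCommGroup E] [NormedSpace ℝ E]
  {M : Type*} [TopologicalSpace M] [ChartedSpace E M]
  {F : Type*} [NormedAddCommGroup F] [NormedSpace ℝ F]

theorem contMDiffAt_clm_of_apply {V : Type*} [NormedAddCommGroup V] [NormedSpace ℝ V]
    [FiniteDimensional ℝ V] {f : M → V →L[ℝ] F} {x : M} (h : ∀ v, CMDiffAt ∞ (fun z ↦ f z v) x) :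
    CMDiffAt ∞ f x := by
  let b := Module.finBasis ℝ V
  have hf : f = fun z ↦ ∑ i, (ContinuousLinearMap.smulRightL ℝ V F
      (b.coord i).toContinuousLinearMap) (f z (b i)) := by
    funext z
    refine ContinuousLinearMap.coe_injective (b.ext fun j ↦ ?_)
    simp [Finsupp.single_apply]
  rw [hf]
  exact contMDiffAt_finsetSum fun i _ ↦ (ContinuousLinearMap.contMDiff _).contMDiffAt.comp x (h _)

theorem mvfderiv_inner {H : Type*} [NormedAddCommGroup H] [InnerProductSpace ℝ H] {f g : M → H}
    {x : M} (hf : MDiffAt f x) (hg : MDiffAt g x) (v : TangentSpace 𝓘(ℝ, E) x) :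
    mvfderiv 𝓘(ℝ, E) (fun z ↦ ⟪f z, g z⟫_ℝ) x v =
      ⟪f x, mvfderiv 𝓘(ℝ, E) g x v⟫_ℝ + ⟪mvfderiv 𝓘(ℝ, E) f x v, g x⟫_ℝ := by
  have hinner : HasFDerivAt (fun p : H × H ↦ ⟪p.1, p.2⟫_ℝ) _ (f x, g x) :=
    (hasFDerivAt_fst (𝕜 := ℝ)).inner ℝ (hasFDerivAt_snd (𝕜 := ℝ))
  have h := hinner.hasMFDerivAt.comp (f := fun z ↦ (f z, g z)) x
    (hf.hasMFDerivAt.prodMk hg.hasMFDerivAt)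
  exact DFunLike.congr_fun h.mfderiv v

variable [IsManifold 𝓘(ℝ, E) ∞ M]

theorem contMDiff_bilin_of_symmL [FiniteDimensional ℝ E]
    (g : (x : M) → TangentSpace 𝓘(ℝ, E) x →L[ℝ] TangentSpace 𝓘(ℝ, E) x →L[ℝ] ℝ)
    (hg : ∀ (c : M) (v w : E), CMDiffAt ∞ (fun z ↦
      g z ((trivializationAt E (TangentSpace 𝓘(ℝ, E)) c).symmL ℝ z v)
        ((trivializationAt E (TangentSpace 𝓘(ℝ, E)) c).symmL ℝ z w)) c) :
    ContMDiff 𝓘(ℝ, E) (𝓘(ℝ, E).prod 𝓘(ℝ, E →L[ℝ] E →L[ℝ] ℝ)) ∞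
      (fun x ↦ TotalSpace.mk' (E →L[ℝ] E →L[ℝ] ℝ)
        (E := fun x : M ↦ TangentSpace 𝓘(ℝ, E) x →L[ℝ] TangentSpace 𝓘(ℝ, E) x →L[ℝ] ℝ)
        x (g x)) := by
  intro c
  rw [contMDiffAt_section]
  refine contMDiffAt_clm_of_apply fun v ↦ contMDiffAt_clm_of_apply fun w ↦ ?_
  refine (hg c v w).congr_of_eventuallyEq ?_
  filter_upwards [(chartAt E c).open_source.mem_nhds (mem_chart_source E c)] with x hx
  have hbase : x ∈ (trivializationAt (E →L[ℝ] ℝ)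
      (fun x : M ↦ TangentSpace 𝓘(ℝ, E) x →L[ℝ] ℝ) c).baseSet := by
    simp [hom_trivializationAt_baseSet, hx]
  simp only [hom_trivializationAt_apply, ContinuousLinearMap.inCoordinates,
    ContinuousLinearMap.comp_apply, Trivialization.continuousLinearMapAt_apply,
    Trivialization.linearMapAt_apply, if_pos hbase]
  simp

end Sections

/-- A global frame of the tangent bundle of `M`, with values in `𝔥`, whose structure functions are
constant: the frame fields are closed under the Lie bracket. The left invariant fields of a Lie
group with Lie algebra `𝔥` are the model case. -/
structure LieFraming (E : Type*) [NormedAddCommGroup E] [NormedSpace ℝ E]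
    (M : Type*) [TopologicalSpace M] [ChartedSpace E M] [IsManifold 𝓘(ℝ, E) ∞ M]
    (𝔥 : Type*) [NormedAddCommGroup 𝔥] [NormedSpace ℝ 𝔥] where
  frame : (x : M) → 𝔥 ≃L[ℝ] TangentSpace 𝓘(ℝ, E) x
  contMDiff_frame : ∀ a, CMDiff ∞ (T% fun x ↦ frame x a)
  bracket : 𝔥 →L[ℝ] 𝔥 →L[ℝ] 𝔥
  mlieBracket_frame : ∀ a b x,
    mlieBracket 𝓘(ℝ, E) (fun z ↦ frame z a) (fun z ↦ frame z b) x = frame x (bracket a b)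

namespace LieFraming

section Smoothness

variable {E : Type*} [NormedAddCommGroup E] [NormedSpace ℝ E]
  {M : Type*} [TopologicalSpace M] [ChartedSpace E M] [IsManifold 𝓘(ℝ, E) ∞ M]
  {𝔥 : Type*} [NormedAddCommGroup 𝔥] [NormedSpace ℝ 𝔥] (Φ : LieFraming E M 𝔥)

/-- The smooth vector fields which are constant in the frame. -/
def fields : 𝔥 →ₗ[ℝ] VectorFields E M where
  toFun a := ⟨fun x ↦ Φ.frame x a, Φ.contMDiff_frame a⟩
  map_add' a b := by ext x; exact map_add (Φ.frame x) a b
  map_smul' r a := by ext x; exact map_smul (Φ.frame x) r a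

theorem fields_injective [Nonempty M] : Function.Injective Φ.fields := fun _ _ h ↦
  (Φ.frame (Classical.arbitrary M)).injective (DFunLike.congr_fun h (Classical.arbitrary M))

/-- The frame obtained by a linear change of parameters. -/
def reparam {𝔥' : Type*} [NormedAddCommGroup 𝔥'] [NormedSpace ℝ 𝔥'] (T : 𝔥' ≃L[ℝ] 𝔥) :
    LieFraming E M 𝔥' where
  frame x := T.trans (Φ.frame x)
  contMDiff_frame a := Φ.contMDiff_frame (T a)
  bracket := ContinuousLinearMap.compL ℝ 𝔥' 𝔥 𝔥' T.symm ∘L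
    Φ.bracket.bilinearComp (T : 𝔥' →L[ℝ] 𝔥) (T : 𝔥' →L[ℝ] 𝔥)
  mlieBracket_frame a b x := (Φ.mlieBracket_frame (T a) (T b) x).trans (by simp)

theorem reparam_bracket_apply {𝔥' : Type*} [NormedAddCommGroup 𝔥'] [NormedSpace ℝ 𝔥']
    (T : 𝔥' ≃L[ℝ] 𝔥) (a b : 𝔥') :
    (Φ.reparam T).bracket a b = T.symm (Φ.bracket (T a) (T b)) := rfl

theorem bracket_antisymm [Nonempty M] (a b : 𝔥) : Φ.bracket a b = -Φ.bracket b a := by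
  let x := Classical.arbitrary M
  apply (Φ.frame x).injective
  rw [map_neg, ← Φ.mlieBracket_frame, ← Φ.mlieBracket_frame, mlieBracket_swap_apply]

theorem bracket_self [Nonempty M] (a : 𝔥) : Φ.bracket a a = 0 := by
  let x := Classical.arbitrary M
  apply (Φ.frame x).injective
  rw [map_zero, ← Φ.mlieBracket_frame, mlieBracket_self, Pi.zero_apply]

theorem coframe_apply_eventuallyEq (Y : (x : M) → TangentSpace 𝓘(ℝ, E) x) (c : M) :
    (fun z ↦ (Φ.frame z).symm (Y z)) =ᶠ[𝓝 c] fun z ↦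
      ((Φ.frame z).symm : TangentSpace 𝓘(ℝ, E) z →L[ℝ] 𝔥).comp
        ((trivializationAt E (TangentSpace 𝓘(ℝ, E)) c).symmL ℝ z)
        (trivializationAt E (TangentSpace 𝓘(ℝ, E)) c ⟨z, Y z⟩).2 := by
  filter_upwards [(trivializationAt E (TangentSpace 𝓘(ℝ, E)) c).open_baseSet.mem_nhds
    (mem_baseSet_trivializationAt E (TangentSpace 𝓘(ℝ, E)) c)] with z hz
  refine congrArg (Φ.frame z).symm ?_
  have h := Trivialization.symmL_continuousLinearMapAt (R := ℝ) _ hz (Y z)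
  rw [Trivialization.continuousLinearMapAt_apply, Trivialization.coe_linearMapAt_of_mem _ hz] at h
  exact h.symm

variable [FiniteDimensional ℝ 𝔥]

theorem contMDiffAt_frame_in_trivialization (c : M) :
    CMDiffAt ∞ (fun z ↦ ((trivializationAt E (TangentSpace 𝓘(ℝ, E)) c).continuousLinearMapAt ℝ z ∘L
      (Φ.frame z : 𝔥 →L[ℝ] TangentSpace 𝓘(ℝ, E) z) : 𝔥 →L[ℝ] E)) c := by
  refine contMDiffAt_clm_of_apply fun a ↦ ?_
  refine ((contMDiffAt_section _).1 (Φ.contMDiff_frame a c)).congr_of_eventuallyEq ?_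
  filter_upwards [(trivializationAt E (TangentSpace 𝓘(ℝ, E)) c).open_baseSet.mem_nhds
    (mem_baseSet_trivializationAt E (TangentSpace 𝓘(ℝ, E)) c)] with z hz
  exact congrFun (Trivialization.coe_linearMapAt_of_mem _ hz) _

theorem contMDiffAt_coframe_symmL (c : M) :
    CMDiffAt ∞ (fun z ↦ (((Φ.frame z).symm : TangentSpace 𝓘(ℝ, E) z →L[ℝ] 𝔥) ∘L
      (trivializationAt E (TangentSpace 𝓘(ℝ, E)) c).symmL ℝ z : E →L[ℝ] 𝔥)) c := by
  let ε := trivializationAt E (TangentSpace 𝓘(ℝ, E)) c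
  have hbase := mem_baseSet_trivializationAt E (TangentSpace 𝓘(ℝ, E)) c
  let L : (z : M) → z ∈ ε.baseSet → 𝔥 ≃L[ℝ] E :=
    fun z hz ↦ (Φ.frame z).trans (ε.continuousLinearEquivAt ℝ z hz)
  have hL : ∀ z (hz : z ∈ ε.baseSet), (ε.continuousLinearMapAt ℝ z ∘L
      (Φ.frame z : 𝔥 →L[ℝ] TangentSpace 𝓘(ℝ, E) z) : 𝔥 →L[ℝ] E) = L z hz :=
    fun z hz ↦ by rw [← ε.coe_continuousLinearEquivAt_eq' hz]; rfl
  have hinv : ContDiffAt ℝ ∞ ContinuousLinearMap.inverse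
      (ε.continuousLinearMapAt ℝ c ∘L (Φ.frame c : 𝔥 →L[ℝ] TangentSpace 𝓘(ℝ, E) c)) := by
    have := FiniteDimensional.complete ℝ 𝔥
    rw [hL c hbase]
    exact contDiffAt_map_inverse _
  refine (hinv.contMDiffAt.comp c
    (Φ.contMDiffAt_frame_in_trivialization c)).congr_of_eventuallyEq ?_
  filter_upwards [ε.open_baseSet.mem_nhds hbase] with z hz
  rw [Function.comp_apply, hL z hz, ContinuousLinearMap.inverse_equiv]
  ext v
  exact congrArg (Φ.frame z).symm (congrFun (ε.symm_continuousLinearEquivAt_eq hz) v).symm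

theorem contMDiffAt_coframe_apply {Y : (x : M) → TangentSpace 𝓘(ℝ, E) x} {x : M}
    (hY : CMDiffAt ∞ (T% Y) x) : CMDiffAt ∞ (fun z ↦ (Φ.frame z).symm (Y z)) x :=
  ((Φ.contMDiffAt_coframe_symmL x).clm_apply ((contMDiffAt_section _).1 hY)).congr_of_eventuallyEq
    (Φ.coframe_apply_eventuallyEq Y x)

theorem mdifferentiableAt_coframe_apply {Y : (x : M) → TangentSpace 𝓘(ℝ, E) x} {x : M}
    (hY : MDiffAt (T% Y) x) : MDiffAt (fun z ↦ (Φ.frame z).symm (Y z)) x :=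
  (((Φ.contMDiffAt_coframe_symmL x).mdifferentiableAt (by simp)).clm_apply
    ((mdifferentiableAt_section _ _).1 hY)).congr_of_eventuallyEq
    (Φ.coframe_apply_eventuallyEq Y x)

end Smoothness

section Metric

variable {E : Type*} [NormedAddCommGroup E] [NormedSpace ℝ E]
  {M : Type*} [TopologicalSpace M] [ChartedSpace E M] [IsManifold 𝓘(ℝ, E) ∞ M]
  {𝔥 : Type*} [NormedAddCommGroup 𝔥] [InnerProductSpace ℝ 𝔥] [FiniteDimensional ℝ 𝔥]
  (Φ : LieFraming E M 𝔥)

/-- The coefficients of the Levi-Civita connection in the frame: `christoffel a b` represents the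
derivative of the frame field of `b` in the direction of the frame field of `a`. The formula is
the Koszul formula, in which the derivatives of the inner products vanish. -/
def christoffel : 𝔥 →ₗ[ℝ] 𝔥 →ₗ[ℝ] 𝔥 :=
  LinearMap.mk₂ ℝ (fun a b ↦ (2 : ℝ)⁻¹ • (Φ.bracket a b -
      ContinuousLinearMap.adjoint (Φ.bracket b) a - ContinuousLinearMap.adjoint (Φ.bracket a) b))
    (fun a a' b ↦ by simp only [map_add, add_apply]; module)
    (fun r a b ↦ by simp only [map_smul, smul_apply]; module)
    (fun a b b' ↦ by simp only [map_add, add_apply]; module)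
    (fun r a b ↦ by simp only [map_smul, smul_apply]; module)

theorem christoffel_apply (a b : 𝔥) : Φ.christoffel a b = (2 : ℝ)⁻¹ • (Φ.bracket a b -
    ContinuousLinearMap.adjoint (Φ.bracket b) a - ContinuousLinearMap.adjoint (Φ.bracket a) b) :=
  rfl

section Nonempty

variable [Nonempty M]

theorem christoffel_sub_christoffel (a b : 𝔥) :
    Φ.christoffel a b - Φ.christoffel b a = Φ.bracket a b := by
  rw [christoffel_apply, christoffel_apply, Φ.bracket_antisymm b a]
  module

theorem christoffel_self (a : 𝔥) :
    Φ.christoffel a a = -ContinuousLinearMap.adjoint (Φ.bracket a) a := by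
  rw [christoffel_apply, Φ.bracket_self]
  module

theorem inner_christoffel_add_inner_christoffel (v a b : 𝔥) :
    ⟪Φ.christoffel v a, b⟫_ℝ + ⟪a, Φ.christoffel v b⟫_ℝ = 0 := by
  simp only [christoffel_apply, real_inner_smul_left, real_inner_smul_right, inner_sub_left,
    inner_sub_right, ContinuousLinearMap.adjoint_inner_left,
    ContinuousLinearMap.adjoint_inner_right]
  rw [Φ.bracket_antisymm b a, inner_neg_left, real_inner_comm v]
  ring

theorem trace_christoffel_flip (a : 𝔥) :
    LinearMap.trace ℝ 𝔥 (Φ.christoffel.flip a) =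
      -LinearMap.trace ℝ 𝔥 (Φ.bracket a).toLinearMap := by
  rw [LinearMap.trace_eq_sum_inner _ (stdOrthonormalBasis ℝ 𝔥),
    LinearMap.trace_eq_sum_inner _ (stdOrthonormalBasis ℝ 𝔥), ← Finset.sum_neg_distrib]
  refine Finset.sum_congr rfl fun i _ ↦ ?_
  rw [LinearMap.flip_apply, christoffel_apply, Φ.bracket_antisymm _ a]
  simp only [real_inner_smul_right, inner_sub_right, inner_neg_right,
    ContinuousLinearMap.adjoint_inner_right, Φ.bracket_self, inner_zero_left,
    ContinuousLinearMap.coe_coe, real_inner_comm (stdOrthonormalBasis ℝ 𝔥 i)]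
  ring

end Nonempty

/-- The Levi-Civita connection of `Φ.metric`. -/
def connection : Connection E M where
  toFun Y x := (Φ.frame x : 𝔥 →L[ℝ] TangentSpace 𝓘(ℝ, E) x) ∘L
    (mvfderiv 𝓘(ℝ, E) (fun z ↦ (Φ.frame z).symm (Y z)) x +
      (Φ.christoffel.flip ((Φ.frame x).symm (Y x))).toContinuousLinearMap ∘L
        ((Φ.frame x).symm : TangentSpace 𝓘(ℝ, E) x →L[ℝ] 𝔥))
  isCovariantDerivativeOnUniv :=
    { add := by
        intro σ σ' x hσ hσ' _
        have h : (fun z ↦ (Φ.frame z).symm ((σ + σ') z)) =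
            (fun z ↦ (Φ.frame z).symm (σ z)) + fun z ↦ (Φ.frame z).symm (σ' z) := by
          ext z; simp
        ext v
        rw [h, mvfderiv_add (Φ.mdifferentiableAt_coframe_apply hσ)
          (Φ.mdifferentiableAt_coframe_apply hσ')]
        simp only [ContinuousLinearMap.comp_apply, add_apply, map_add,
          Pi.add_apply, LinearMap.coe_toContinuousLinearMap', LinearMap.flip_apply]
        abel
      leibniz := by
        intro σ f x hσ hf _
        have h : (fun z ↦ (Φ.frame z).symm ((f • σ) z)) =
            f • (fun z ↦ (Φ.frame z).symm (σ z)) := by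
          ext z; simp
        ext v
        rw [h, mvfderiv_smul hf (Φ.mdifferentiableAt_coframe_apply hσ)]
        simp only [ContinuousLinearMap.comp_apply, add_apply, map_add,
          Pi.smul_apply', LinearMap.coe_toContinuousLinearMap', LinearMap.flip_apply,
          smul_apply, map_smul, ContinuousLinearMap.smulRight_apply,
          ContinuousLinearEquiv.coe_coe, ContinuousLinearEquiv.apply_symm_apply, smul_add]
        abel }

theorem coframe_connection (Y : (x : M) → TangentSpace 𝓘(ℝ, E) x) (x : M)
    (v : TangentSpace 𝓘(ℝ, E) x) :
    (Φ.frame x).symm (Φ.connection Y x v) =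
      mvfderiv 𝓘(ℝ, E) (fun z ↦ (Φ.frame z).symm (Y z)) x v +
        Φ.christoffel ((Φ.frame x).symm v) ((Φ.frame x).symm (Y x)) :=
  (Φ.frame x).symm_apply_apply _

theorem connection_frame (a : 𝔥) (x : M) (v : TangentSpace 𝓘(ℝ, E) x) :
    Φ.connection (fun z ↦ Φ.frame z a) x v =
      Φ.frame x (Φ.christoffel ((Φ.frame x).symm v) a) := by
  apply (Φ.frame x).symm.injective
  simp [coframe_connection, mvfderiv_const]

theorem divergence_frame [Nonempty M] (a : 𝔥) (x : M) :
    divergence Φ.connection (fun z ↦ Φ.frame z a) x =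
      -LinearMap.trace ℝ 𝔥 (Φ.bracket a).toLinearMap := by
  have hconj : (Φ.connection (fun z ↦ Φ.frame z a) x).toLinearMap =
      (Φ.frame x).toLinearEquiv.conj (Φ.christoffel.flip a) :=
    LinearMap.ext fun v ↦ Φ.connection_frame a x v
  rw [divergence, hconj, LinearMap.trace_conj', trace_christoffel_flip]

variable [FiniteDimensional ℝ E]

/-- The Riemannian metric for which the frame is isometric. -/
def metric : RiemMetric E M where
  inner x := ((Φ.frame x).symm : TangentSpace 𝓘(ℝ, E) x →L[ℝ] 𝔥).precomp ℝ ∘L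
    (innerSL ℝ ∘L ((Φ.frame x).symm : TangentSpace 𝓘(ℝ, E) x →L[ℝ] 𝔥))
  symm x v w := real_inner_comm _ _
  pos x v hv := real_inner_self_pos.2 ((Φ.frame x).symm.map_ne_zero_iff.2 hv)
  isVonNBounded x := by
    refine ((NormedSpace.isVonNBounded_ball ℝ 𝔥 1).image
      (Φ.frame x : 𝔥 →L[ℝ] TangentSpace 𝓘(ℝ, E) x)).subset ?_
    intro v (hv : ⟪(Φ.frame x).symm v, (Φ.frame x).symm v⟫_ℝ < 1)
    refine ⟨(Φ.frame x).symm v, ?_, (Φ.frame x).apply_symm_apply v⟩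
    rwa [mem_ball_zero_iff, ← sq_lt_one_iff₀ (norm_nonneg _), ← real_inner_self_eq_norm_sq]
  contMDiff := contMDiff_bilin_of_symmL _ fun c v w ↦ by
    have h := Φ.contMDiffAt_coframe_symmL c
    exact (contDiff_inner (𝕜 := ℝ)).contMDiff.contMDiffAt.comp c
      ((h.clm_apply contMDiffAt_const).prodMk_space (h.clm_apply contMDiffAt_const))

theorem metric_inner (x : M) (v w : TangentSpace 𝓘(ℝ, E) x) :
    Φ.metric.inner x v w = ⟪(Φ.frame x).symm v, (Φ.frame x).symm w⟫_ℝ := rfl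

theorem torsion_connection [Nonempty M] (x : M) (v w : TangentSpace 𝓘(ℝ, E) x) :
    Φ.connection.torsion x v w = 0 := by
  obtain ⟨a, rfl⟩ := (Φ.frame x).surjective v
  obtain ⟨b, rfl⟩ := (Φ.frame x).surjective w
  have hsmooth : ∀ a, MDiffAt (T% fun z ↦ Φ.frame z a) x :=
    fun a ↦ (Φ.contMDiff_frame a).mdifferentiable (by simp) x
  rw [Φ.connection.torsion_apply (hsmooth a) (hsmooth b), connection_frame, connection_frame,
    mlieBracket_frame, ← Φ.christoffel_sub_christoffel]
  simp

theorem isLeviCivita : IsLeviCivita Φ.metric Φ.connection where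
  torsion_free X Y x hX hY := by
    have : Nonempty M := ⟨x⟩
    rw [← sub_eq_zero, ← Φ.connection.torsion_apply hX hY, torsion_connection]
  metric_compatible Y Z x hY hZ v := by
    have : Nonempty M := ⟨x⟩
    have h := mvfderiv_inner (Φ.mdifferentiableAt_coframe_apply hY)
      (Φ.mdifferentiableAt_coframe_apply hZ) v
    simp only [metric_inner, coframe_connection, inner_add_left, inner_add_right, h]
    linarith [Φ.inner_christoffel_add_inner_christoffel ((Φ.frame x).symm v)
      ((Φ.frame x).symm (Y x)) ((Φ.frame x).symm (Z x))]

theorem isOrientable [Nonempty M] (Φ : LieFraming E M 𝔥) : IsOrientable E M := by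
  let b : Module.Basis (Fin (Module.finrank ℝ E)) ℝ 𝔥 :=
    (Module.finBasis ℝ E).map (Φ.frame (Classical.arbitrary M)).symm.toLinearEquiv
  refine ⟨fun x ↦ b.det.compLinearMap (Φ.frame x).symm.toLinearEquiv.toLinearMap,
    fun x h ↦ ?_, fun X ↦ ?_⟩
  · have hdet : b.det b = 0 := by
      simpa [AlternatingMap.compLinearMap_apply] using
        DFunLike.congr_fun h fun i ↦ Φ.frame x (b i)
    simp [b.det_self] at hdet
  · have hcoframe : ∀ i, CMDiff ∞ (fun x ↦ (Φ.frame x).symm (X i x)) :=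
      fun i x ↦ Φ.contMDiffAt_coframe_apply ((X i).contMDiff x)
    have hdet : ContDiff ℝ ∞ b.det := by
      have hcoord (i) : ContDiff ℝ ∞ (b.coord i) := (b.coord i).toContinuousLinearMap.contDiff
      simp only [funext b.det_apply, Matrix.det_apply', b.toMatrix_apply, ← b.coord_apply]
      fun_prop
    exact hdet.contMDiff.comp (contMDiff_pi_space.2 hcoframe)

end Metric

/-- The Riemannian manifold with the metric for which the frame is isometric. -/
abbrev manifold {E M : Type} [NormedAddCommGroup E] [NormedSpace ℝ E] [FiniteDimensional ℝ E]
    [TopologicalSpace M] [ChartedSpace E M] [IsManifold 𝓘(ℝ, E) ∞ M]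
    [T2Space M] [CompactSpace M] [ConnectedSpace M]
    {𝔥 : Type*} [NormedAddCommGroup 𝔥] [InnerProductSpace ℝ 𝔥] [FiniteDimensional ℝ 𝔥]
    (Φ : LieFraming E M 𝔥) : CompactRiemannianManifold where
  E := E
  M := M
  orientable := Φ.isOrientable
  g := Φ.metric

end LieFraming

theorem gradient_zero {E : Type*} [NormedAddCommGroup E] [NormedSpace ℝ E] [FiniteDimensional ℝ E]
    {M : Type*} [TopologicalSpace M] [ChartedSpace E M] [IsManifold 𝓘(ℝ, E) ∞ M]
    (g : RiemMetric E M) (x : M) : gradient g 0 x = 0 := by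
  rw [gradient, mvfderiv_zero]
  exact map_zero _

theorem LieFraming.embedsIntoEuler {E M : Type} [NormedAddCommGroup E] [NormedSpace ℝ E]
    [FiniteDimensional ℝ E] [TopologicalSpace M] [ChartedSpace E M] [IsManifold 𝓘(ℝ, E) ∞ M]
    [T2Space M] [CompactSpace M] [ConnectedSpace M]
    {𝔥 : Type*} [NormedAddCommGroup 𝔥] [InnerProductSpace ℝ 𝔥] [FiniteDimensional ℝ 𝔥]
    (Φ : LieFraming E M 𝔥)
    {V : Type*} [NormedAddCommGroup V] [NormedSpace ℝ V] [FiniteDimensional ℝ V]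
    (B : V →ₗ[ℝ] V →ₗ[ℝ] V) (U : V →ₗ[ℝ] 𝔥) (hU : Function.Injective U)
    (hB : ∀ y, ContinuousLinearMap.adjoint (Φ.bracket (U y)) (U y) = U (B y y))
    (htrace : ∀ y, LinearMap.trace ℝ 𝔥 (Φ.bracket (U y)).toLinearMap = 0) :
    EmbedsIntoEuler B Φ.manifold := by
  refine ⟨Φ.connection, Φ.isLeviCivita, Φ.fields ∘ₗ U, 0, Φ.fields_injective.comp hU,
    fun J y _ hy t ht x ↦ ⟨⟨Φ.frame x (U (B (y t) (y t))), ?_, ?_⟩, ?_⟩⟩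
  · let L : V →L[ℝ] E := (Φ.frame x : 𝔥 →L[ℝ] TangentSpace 𝓘(ℝ, E) x) ∘L U.toContinuousLinearMap
    exact L.hasFDerivAt.comp_hasDerivWithinAt t (hy t ht)
  · have hconn : Φ.connection (fun z ↦ Φ.frame z (U (y t))) x (Φ.frame x (U (y t))) =
        -Φ.frame x (U (B (y t) (y t))) := by
      rw [connection_frame, ContinuousLinearEquiv.symm_apply_apply, christoffel_self, hB, map_neg]
    have hgrad : -gradient Φ.manifold.g ((0 : ScalarFields E M) : M → ℝ) x = 0 :=
      neg_eq_zero.2 (gradient_zero _ x)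
    exact (congrArg (Φ.frame x (U (B (y t) (y t))) + ·) hconn).trans
      ((add_neg_cancel _).trans hgrad.symm)
  · exact (Φ.divergence_frame (U (y t)) x).trans (by rw [htrace, neg_zero])

/-! ### The unitary group in Cayley coordinates -/

section Cayley

variable {R : Type*} [Ring R] {a r : R}

/-- The Cayley transform, normalized so that its derivative at `0` is the identity. -/
def cayley (a : R) : R := (2 + a) * Ring.inverse (2 - a)

/-- The inverse of the Cayley transform. -/
def cayleyInv (r : R) : R := 2 * (r - 1) * Ring.inverse (r + 1)

theorem cayley_mul_two_sub (ha : IsUnit (2 - a)) : cayley a * (2 - a) = 2 + a :=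
  Ring.inverse_mul_cancel_right _ _ ha

theorem cayleyInv_mul_add_one (hr : IsUnit (r + 1)) : cayleyInv r * (r + 1) = 2 * (r - 1) :=
  Ring.inverse_mul_cancel_right _ _ hr

theorem isUnit_cayley_add_one (h2 : IsUnit (2 : R)) (ha : IsUnit (2 - a)) :
    IsUnit (cayley a + 1) := by
  have h : (cayley a + 1) * (2 - a) = 2 * 2 := by
    rw [add_mul, cayley_mul_two_sub ha]
    grind
  rw [(Ring.eq_mul_inverse_iff_mul_eq _ _ _ ha).2 h]
  exact (h2.mul h2).mul ha.ringInverse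

theorem cayleyInv_cayley (h2 : IsUnit (2 : R)) (ha : IsUnit (2 - a)) :
    cayleyInv (cayley a) = a := by
  have hu := isUnit_cayley_add_one h2 ha
  apply hu.mul_right_cancel
  apply ha.mul_right_cancel
  rw [cayleyInv_mul_add_one hu]
  simp only [mul_assoc, add_mul, sub_mul, cayley_mul_two_sub ha]
  grind

theorem cayley_cayleyInv (h2 : IsUnit (2 : R)) (hr : IsUnit (r + 1)) :
    cayley (cayleyInv r) = r := by
  have h : (2 - cayleyInv r) * (r + 1) = 2 * 2 := by
    rw [sub_mul, cayleyInv_mul_add_one hr]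
    grind
  have hu : IsUnit (2 - cayleyInv r) := by
    rw [(Ring.eq_mul_inverse_iff_mul_eq _ _ _ hr).2 h]
    exact (h2.mul h2).mul hr.ringInverse
  apply hu.mul_right_cancel
  apply hr.mul_right_cancel
  rw [cayley_mul_two_sub hu, mul_assoc, h, add_mul, cayleyInv_mul_add_one hr]
  noncomm_ring

theorem cayley_mem_unitary [StarRing R] (ha : a ∈ skewAdjoint R) (hu : IsUnit (2 - a)) :
    cayley a ∈ unitary R := by
  have hstar : star (2 - a) = 2 + a := by
    rw [star_sub, skewAdjoint.mem_iff.1 ha, star_ofNat, sub_neg_eq_add]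
  have hcomm : (2 + a) * (2 - a) = (2 - a) * (2 + a) := by noncomm_ring
  have hc : star (cayley a) * (2 + a) = 2 - a := by
    have hu' : IsUnit (2 + a) := hstar ▸ hu.star
    apply hu'.mul_left_cancel
    rw [← mul_assoc, ← hstar, ← star_mul, cayley_mul_two_sub hu, ← hstar, star_star, hstar, hcomm]
  have hc' : star (cayley a) * cayley a = 1 := by
    apply hu.mul_right_cancel
    rw [mul_assoc, cayley_mul_two_sub hu, hc, one_mul]
  refine Unitary.mem_iff.2 ⟨hc', ?_⟩
  apply (hstar ▸ hu.star : IsUnit (2 + a)).mul_right_cancel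
  rw [mul_assoc, hc, cayley_mul_two_sub hu, one_mul]

theorem cayleyInv_mem_skewAdjoint [StarRing R] (hr : r ∈ unitary R) (hu : IsUnit (r + 1)) :
    cayleyInv r ∈ skewAdjoint R := by
  have hstar : (star r + 1) * star (cayleyInv r) = (star r - 1) * 2 := by
    simpa using congrArg star (cayleyInv_mul_add_one hu)
  have hstar' : (r + 1) * star (cayleyInv r) = (1 - r) * 2 := by
    have h := congrArg (r * ·) hstar
    simp only [← mul_assoc, mul_add, mul_sub, Unitary.mul_star_self_of_mem hr, mul_one] at h
    rwa [add_comm r]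
  rw [skewAdjoint.mem_iff]
  apply hu.mul_left_cancel
  apply hu.mul_right_cancel
  rw [hstar', mul_assoc (r + 1), neg_mul, cayleyInv_mul_add_one hu]
  noncomm_ring

end Cayley

section CayleyAnalysis

variable {𝒜 : Type*} [NormedRing 𝒜] [NormedAlgebra ℝ 𝒜]

variable (𝒜) in
theorem isUnit_two_of_normedAlgebra : IsUnit (2 : 𝒜) :=
  map_ofNat (algebraMap ℝ 𝒜) 2 ▸ (two_ne_zero (α := ℝ)).isUnit.map (algebraMap ℝ 𝒜)

theorem contDiffAt_cayley [HasSummableGeomSeries 𝒜] {a : 𝒜} (ha : IsUnit (2 - a)) :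
    ContDiffAt ℝ ∞ cayley a := by
  obtain ⟨u, hu⟩ := ha
  have hinv : ContDiffAt ℝ ∞ Ring.inverse (2 - a) := hu ▸ contDiffAt_ringInverse ℝ u
  exact (contDiffAt_const.add contDiffAt_id).mul
    (hinv.comp a (contDiffAt_const.sub contDiffAt_id))

theorem contDiffAt_cayleyInv [HasSummableGeomSeries 𝒜] {r : 𝒜} (hr : IsUnit (r + 1)) :
    ContDiffAt ℝ ∞ cayleyInv r := by
  obtain ⟨u, hu⟩ := hr
  have hinv : ContDiffAt ℝ ∞ Ring.inverse (r + 1) := hu ▸ contDiffAt_ringInverse ℝ u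
  exact (contDiffAt_const.mul (contDiffAt_id.sub contDiffAt_const)).mul
    (hinv.comp r (contDiffAt_id.add contDiffAt_const))

theorem hasFDerivAt_cayley_zero [HasSummableGeomSeries 𝒜] :
    HasFDerivAt cayley (ContinuousLinearMap.id ℝ 𝒜) 0 := by
  obtain ⟨u, hu⟩ := isUnit_two_of_normedAlgebra 𝒜
  have hinv : HasFDerivAt (𝕜 := ℝ) Ring.inverse
      (-ContinuousLinearMap.mulLeftRight ℝ 𝒜 ↑u⁻¹ ↑u⁻¹) (2 - 0 : 𝒜) := by
    rw [sub_zero, ← hu]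
    exact hasFDerivAt_ringInverse u
  have h := ((hasFDerivAt_id (𝕜 := ℝ) (0 : 𝒜)).const_add 2).mul'
    (hinv.comp (0 : 𝒜) ((hasFDerivAt_id (𝕜 := ℝ) (0 : 𝒜)).const_sub 2))
  refine h.congr_fderiv (ContinuousLinearMap.ext fun v ↦ ?_)
  have hv : (2 + 0) * -(↑u⁻¹ * (-v) * ↑u⁻¹) + v * Ring.inverse (2 - (0 : 𝒜)) = v := by
    simp only [add_zero, sub_zero, ← hu, Ring.inverse_unit, mul_neg, neg_mul, neg_neg, mul_assoc,
      Units.mul_inv_cancel_left]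
    rw [← mul_add, ← two_mul, ← hu, Units.mul_inv, mul_one]
  exact hv

theorem isUnit_two_sub_of_mem_skewAdjoint [StarRing 𝒜] [CStarRing 𝒜] [FiniteDimensional ℝ 𝒜]
    {a : 𝒜} (ha : a ∈ skewAdjoint 𝒜) : IsUnit (2 - a) := by
  have : IsArtinianRing 𝒜 := IsArtinianRing.of_finite ℝ 𝒜
  refine IsArtinianRing.isUnit_iff_isRightRegular.2
    (isRightRegular_iff_left_eq_zero_of_mul.2 fun x hx ↦ ?_)
  have hxa : x * a = x * 2 := by rw [mul_sub, sub_eq_zero] at hx; exact hx.symm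
  have hax : a * star x = -(2 * star x) := by
    have h := congrArg star hxa
    rw [star_mul, star_mul, skewAdjoint.mem_iff.1 ha, star_ofNat, neg_mul] at h
    rw [← h, neg_neg]
  have h4 : (4 : ℝ) • (x * star x) = 0 := by
    have h : x * 2 * star x = -(x * (2 * star x)) := by rw [← hxa, mul_assoc, hax, mul_neg]
    rw [mul_assoc, eq_neg_iff_add_eq_zero] at h
    rw [← h, two_mul, mul_add]
    module
  exact (CStarRing.mul_star_self_eq_zero_iff x).1 ((smul_eq_zero.1 h4).resolve_left (by simp))

end CayleyAnalysis

/-- The identity component of the unitary group of `𝒜`, a compact Lie group with Cayley charts. -/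
abbrev UnitaryComponent (𝒜 : Type*) [NormedRing 𝒜] [StarRing 𝒜] : Type _ :=
  connectedComponent (1 : unitary 𝒜)

/-- The Lie algebra of the unitary group of `𝒜`. -/
abbrev Skew (𝒜 : Type*) [NormedRing 𝒜] [NormedAlgebra ℝ 𝒜] [StarRing 𝒜] [StarModule ℝ 𝒜] :
    Type _ :=
  skewAdjoint.submodule ℝ 𝒜

section Unitary

variable {𝒜 : Type*} [NormedRing 𝒜] [StarRing 𝒜]

/-- The inclusion of the identity component of the unitary group into the algebra. -/
def unitaryVal (P : UnitaryComponent 𝒜) : 𝒜 := (P : unitary 𝒜)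

theorem continuous_unitaryVal : Continuous (unitaryVal (𝒜 := 𝒜)) :=
  continuous_subtype_val.comp continuous_subtype_val

theorem star_unitaryVal_mul (P : UnitaryComponent 𝒜) : star (unitaryVal P) * unitaryVal P = 1 :=
  Unitary.coe_star_mul_self (P : unitary 𝒜)

theorem unitaryVal_mul_star (P : UnitaryComponent 𝒜) : unitaryVal P * star (unitaryVal P) = 1 :=
  Unitary.coe_mul_star_self (P : unitary 𝒜)

theorem unitaryVal_injective : Function.Injective (unitaryVal (𝒜 := 𝒜)) :=
  Subtype.val_injective.comp Subtype.val_injective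

theorem star_unitaryVal_mul_mem (P Q : UnitaryComponent 𝒜) :
    star (unitaryVal P) * unitaryVal Q ∈ unitary 𝒜 :=
  mul_mem (Unitary.star_mem (P : unitary 𝒜).2) (Q : unitary 𝒜).2

instance [CStarRing 𝒜] [ProperSpace 𝒜] : CompactSpace (UnitaryComponent 𝒜) := by
  have hbdd : Bornology.IsBounded (unitary 𝒜 : Set 𝒜) := by
    refine (Metric.isBounded_closedBall (x := (0 : 𝒜)) (r := ‖(1 : 𝒜)‖)).subset fun u hu ↦ ?_
    have h := CStarRing.norm_mul_mem_unitary (1 : 𝒜) hu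
    rw [one_mul] at h
    simp [h]
  have : CompactSpace (unitary 𝒜) :=
    isCompact_iff_compactSpace.1 (Metric.isCompact_of_isClosed_isBounded isClosed_unitary hbdd)
  exact isCompact_iff_compactSpace.1 isClosed_connectedComponent.isCompact

instance : ConnectedSpace (UnitaryComponent 𝒜) :=
  isConnected_iff_connectedSpace.1 isConnected_connectedComponent

end Unitary

section CayleyCoordinates

variable {𝒜 : Type*} [NormedRing 𝒜] [NormedAlgebra ℝ 𝒜] [StarRing 𝒜] [StarModule ℝ 𝒜]
  [CStarRing 𝒜]

variable (𝒜) in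
/-- The skew-adjoint part of an element of `𝒜`. -/
def skewPart : 𝒜 →L[ℝ] Skew 𝒜 := skewAdjointPartL ℝ 𝒜

theorem skewPart_coe (a : Skew 𝒜) : skewPart 𝒜 (a : 𝒜) = a :=
  LinearMap.congr_fun (skewAdjointPart_comp_subtype_skewAdjoint (R := ℝ) (A := 𝒜)) a

/-- The Cayley coordinates based at `p`, extended to the whole algebra. -/
def cayleyCoord (p x : 𝒜) : Skew 𝒜 := skewPart 𝒜 (cayleyInv (star p * x))

theorem cayleyCoord_self (P : UnitaryComponent 𝒜) :
    cayleyCoord (unitaryVal P) (unitaryVal P) = 0 := by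
  rw [cayleyCoord, star_unitaryVal_mul, cayleyInv, sub_self, mul_zero, zero_mul, map_zero]

variable [FiniteDimensional ℝ 𝒜]

theorem contDiff_mul_cayley (p : 𝒜) : ContDiff ℝ ∞ fun a : Skew 𝒜 ↦ p * cayley (a : 𝒜) := by
  have : CompleteSpace 𝒜 := FiniteDimensional.complete ℝ 𝒜
  exact contDiff_iff_contDiffAt.2 fun a ↦ contDiffAt_const.mul
    ((contDiffAt_cayley (isUnit_two_sub_of_mem_skewAdjoint a.2)).comp a
      (skewAdjoint.submodule ℝ 𝒜).subtypeL.contDiff.contDiffAt)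

theorem contDiffAt_cayleyCoord {p x : 𝒜} (hx : IsUnit (star p * x + 1)) :
    ContDiffAt ℝ ∞ (cayleyCoord p) x := by
  have : CompleteSpace 𝒜 := FiniteDimensional.complete ℝ 𝒜
  exact (skewPart 𝒜).contDiff.contDiffAt.comp x
    ((contDiffAt_cayleyInv hx).comp x (contDiffAt_const.mul contDiffAt_id))

/-- The unitary element with Cayley coordinates `a` based at `P`. -/
def cayleyPoint (P : UnitaryComponent 𝒜) (a : Skew 𝒜) : unitary 𝒜 :=
  P * ⟨cayley (a : 𝒜), cayley_mem_unitary a.2 (isUnit_two_sub_of_mem_skewAdjoint a.2)⟩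

theorem continuous_cayleyPoint (P : UnitaryComponent 𝒜) : Continuous (cayleyPoint P) :=
  Continuous.subtype_mk (contDiff_mul_cayley (unitaryVal P)).continuous _

theorem cayleyPoint_mem (P : UnitaryComponent 𝒜) (a : Skew 𝒜) :
    cayleyPoint P a ∈ connectedComponent (1 : unitary 𝒜) := by
  have h0 : cayleyPoint P 0 = P := by
    refine Subtype.ext ?_
    change unitaryVal P * ((2 + 0) * Ring.inverse (2 - 0)) = unitaryVal P
    rw [add_zero, sub_zero, Ring.mul_inverse_cancel _ (isUnit_two_of_normedAlgebra 𝒜), mul_one]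
  rw [connectedComponent_eq P.2]
  exact (isPreconnected_range (continuous_cayleyPoint P)).subset_connectedComponent ⟨0, h0⟩ ⟨a, rfl⟩

/-- The Cayley chart centred at `P`. -/
def cayleyChart (P : UnitaryComponent 𝒜) :
    OpenPartialHomeomorph (UnitaryComponent 𝒜) (Skew 𝒜) where
  toFun Q := cayleyCoord (unitaryVal P) (unitaryVal Q)
  invFun a := ⟨cayleyPoint P a, cayleyPoint_mem P a⟩
  source := {Q | IsUnit (star (unitaryVal P) * unitaryVal Q + 1)}
  target := univ
  map_source' _ _ := mem_univ _
  map_target' a _ := by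
    change IsUnit (star (unitaryVal P) * (unitaryVal P * cayley (a : 𝒜)) + 1)
    rw [← mul_assoc, star_unitaryVal_mul, one_mul]
    exact isUnit_cayley_add_one (isUnit_two_of_normedAlgebra 𝒜)
      (isUnit_two_sub_of_mem_skewAdjoint a.2)
  left_inv' Q hQ := by
    apply unitaryVal_injective
    change unitaryVal P * cayley (skewPart 𝒜 (cayleyInv (star (unitaryVal P) * unitaryVal Q)) : 𝒜)
      = unitaryVal Q
    have hskew := cayleyInv_mem_skewAdjoint (star_unitaryVal_mul_mem P Q) hQ
    rw [show skewPart 𝒜 (cayleyInv (star (unitaryVal P) * unitaryVal Q)) = ⟨_, hskew⟩ from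
      skewPart_coe ⟨_, hskew⟩, cayley_cayleyInv (isUnit_two_of_normedAlgebra 𝒜) hQ, ← mul_assoc,
      unitaryVal_mul_star, one_mul]
  right_inv' a _ := by
    change skewPart 𝒜 (cayleyInv (star (unitaryVal P) * (unitaryVal P * cayley (a : 𝒜)))) = a
    rw [← mul_assoc, star_unitaryVal_mul, one_mul,
      cayleyInv_cayley (isUnit_two_of_normedAlgebra 𝒜) (isUnit_two_sub_of_mem_skewAdjoint a.2),
      skewPart_coe]
  open_source := by
    have : CompleteSpace 𝒜 := FiniteDimensional.complete ℝ 𝒜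
    exact Units.isOpen.preimage ((continuous_const.mul continuous_unitaryVal).add continuous_const)
  open_target := isOpen_univ
  continuousOn_toFun := fun Q hQ ↦ ContinuousAt.continuousWithinAt
    (ContinuousAt.comp (g := cayleyCoord (unitaryVal P)) (contDiffAt_cayleyCoord hQ).continuousAt
      continuous_unitaryVal.continuousAt)
  continuousOn_invFun := (Continuous.subtype_mk (continuous_cayleyPoint P) _).continuousOn

theorem mem_cayleyChart_source (P : UnitaryComponent 𝒜) : P ∈ (cayleyChart P).source := by
  change IsUnit (star (unitaryVal P) * unitaryVal P + 1)
  rw [star_unitaryVal_mul, one_add_one_eq_two]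
  exact isUnit_two_of_normedAlgebra 𝒜

instance : ChartedSpace (Skew 𝒜) (UnitaryComponent 𝒜) where
  atlas := range cayleyChart
  chartAt := cayleyChart
  mem_chart_source := mem_cayleyChart_source
  chart_mem_atlas P := ⟨P, rfl⟩

instance : IsManifold 𝓘(ℝ, Skew 𝒜) ∞ (UnitaryComponent 𝒜) := by
  apply isManifold_of_contDiffOn
  rintro _ _ ⟨P, rfl⟩ ⟨Q, rfl⟩ a ⟨ha, -⟩
  rw [preimage, mem_ofPred_eq, OpenPartialHomeomorph.trans_source] at ha
  have hQ : IsUnit (star (unitaryVal Q) * (unitaryVal P * cayley (a : 𝒜)) + 1) := ha.2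
  exact ((contDiffAt_cayleyCoord hQ).comp a
    (contDiff_mul_cayley (unitaryVal P)).contDiffAt).contDiffWithinAt

theorem contMDiff_unitaryVal :
    ContMDiff 𝓘(ℝ, Skew 𝒜) 𝓘(ℝ, 𝒜) ∞ (unitaryVal (𝒜 := 𝒜)) := fun P ↦
  contMDiffAt_iff.2 ⟨continuous_unitaryVal.continuousAt,
    (contDiff_mul_cayley (unitaryVal P)).contDiffAt.contDiffWithinAt⟩

theorem mvfderiv_unitaryVal (P : UnitaryComponent 𝒜) (v : Skew 𝒜) :
    mvfderiv 𝓘(ℝ, Skew 𝒜) (unitaryVal (𝒜 := 𝒜)) P v = unitaryVal P * (v : 𝒜) := by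
  have : CompleteSpace 𝒜 := FiniteDimensional.complete ℝ 𝒜
  have hcoord : extChartAt 𝓘(ℝ, Skew 𝒜) P P = 0 := cayleyCoord_self P
  have hval := (contMDiff_unitaryVal.mdifferentiable (by simp) P).mvfderiv
  rw [ModelWithCorners.range_eq_univ, fderivWithin_univ, hcoord] at hval
  have hcayley : HasFDerivAt (fun a : Skew 𝒜 ↦ unitaryVal P * cayley (a : 𝒜)) _ 0 :=
    ((hasFDerivAt_cayley_zero (𝒜 := 𝒜)).comp (0 : Skew 𝒜)
      (skewAdjoint.submodule ℝ 𝒜).subtypeL.hasFDerivAt).const_mul (unitaryVal P)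
  exact DFunLike.congr_fun (hval.trans hcayley.fderiv) v

theorem mvfderiv_unitaryVal_injective (P : UnitaryComponent 𝒜) :
    Function.Injective (mvfderiv 𝓘(ℝ, Skew 𝒜) (unitaryVal (𝒜 := 𝒜)) P) := fun v w h ↦ by
  have h' := (mvfderiv_unitaryVal P v).symm.trans (h.trans (mvfderiv_unitaryVal P w))
  have h'' := congrArg (star (unitaryVal P) * ·) h'
  simp only [← mul_assoc, star_unitaryVal_mul, one_mul] at h''
  exact Subtype.ext h''

theorem contMDiff_of_mvfderiv_unitaryVal
    {X : (P : UnitaryComponent 𝒜) → TangentSpace 𝓘(ℝ, Skew 𝒜) P} {R : 𝒜 → 𝒜}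
    (hR : ContDiff ℝ ∞ R)
    (h : ∀ P, mvfderiv 𝓘(ℝ, Skew 𝒜) unitaryVal P (X P) = R (unitaryVal P)) :
    ContMDiff 𝓘(ℝ, Skew 𝒜) (𝓘(ℝ, Skew 𝒜).prod 𝓘(ℝ, Skew 𝒜)) ∞
      (fun P ↦ TotalSpace.mk' (Skew 𝒜) (E := TangentSpace 𝓘(ℝ, Skew 𝒜)) P (X P)) := by
  intro P
  rw [contMDiffAt_section]
  have hcoord : ContDiffAt ℝ ∞ (fun x ↦ fderiv ℝ (cayleyCoord (unitaryVal P)) x (R x))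
      (unitaryVal P) :=
    ((contDiffAt_cayleyCoord (mem_cayleyChart_source P)).fderiv_right (m := ∞) (by simp)).clm_apply
      hR.contDiffAt
  refine (hcoord.contMDiffAt.comp P contMDiff_unitaryVal.contMDiffAt).congr_of_eventuallyEq ?_
  filter_upwards [(cayleyChart P).open_source.mem_nhds (mem_cayleyChart_source P)] with Q hQ
  have : IsManifold 𝓘(ℝ, Skew 𝒜) 1 (UnitaryComponent 𝒜) := IsManifold.of_le (n := ∞) (by simp)
  have hX : (trivializationAt (Skew 𝒜) (TangentSpace 𝓘(ℝ, Skew 𝒜)) P ⟨Q, X Q⟩).2 =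
      mfderiv 𝓘(ℝ, Skew 𝒜) 𝓘(ℝ, Skew 𝒜) (extChartAt 𝓘(ℝ, Skew 𝒜) P) Q (X Q) := by
    refine Eq.trans ?_ (DFunLike.congr_fun (TangentBundle.continuousLinearMapAt_trivializationAt
      (I := 𝓘(ℝ, Skew 𝒜)) (x₀ := P) (x := Q) hQ) (X Q))
    rw [Trivialization.continuousLinearMapAt_apply, Trivialization.linearMapAt_apply, if_pos]
    rwa [TangentBundle.trivializationAt_baseSet]
  have hcomp : HasMFDerivAt 𝓘(ℝ, Skew 𝒜) 𝓘(ℝ, Skew 𝒜)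
      (cayleyCoord (unitaryVal P) ∘ unitaryVal) Q _ :=
    ((contDiffAt_cayleyCoord hQ).differentiableAt (by simp)).hasFDerivAt.hasMFDerivAt.comp Q
      (contMDiff_unitaryVal.mdifferentiable (by simp) Q).hasMFDerivAt
  exact hX.trans ((DFunLike.congr_fun hcomp.mfderiv (X Q)).trans
    (congrArg (fderiv ℝ (cayleyCoord (unitaryVal P)) (unitaryVal Q)) (h Q)))

/-- The frame on the identity component of the unitary group whose fields are the restrictions of
the vector fields `ρ a` of the algebra. The invertible map `L P` is `ρ` read in the left
trivialization of the tangent space at `P`. -/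
def unitaryFraming {𝔥 : Type*} [NormedAddCommGroup 𝔥] [NormedSpace ℝ 𝔥] (ρ : 𝔥 → 𝒜 → 𝒜)
    (hρ : ∀ a, ContDiff ℝ ∞ (ρ a)) (L : UnitaryComponent 𝒜 → 𝔥 ≃L[ℝ] Skew 𝒜)
    (hL : ∀ P a, unitaryVal P * (L P a : 𝒜) = ρ a (unitaryVal P)) (bracket : 𝔥 →L[ℝ] 𝔥 →L[ℝ] 𝔥)
    (hbracket : ∀ a b x, fderiv ℝ (ρ b) x (ρ a x) - fderiv ℝ (ρ a) x (ρ b x) = ρ (bracket a b) x) :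
    LieFraming (Skew 𝒜) (UnitaryComponent 𝒜) 𝔥 :=
  have hderiv (a : 𝔥) (P : UnitaryComponent 𝒜) :
      mvfderiv 𝓘(ℝ, Skew 𝒜) unitaryVal P (L P a) = ρ a (unitaryVal P) :=
    (mvfderiv_unitaryVal P (L P a)).trans (hL P a)
  have hsmooth (a : 𝔥) := contMDiff_of_mvfderiv_unitaryVal (X := fun P ↦ L P a) (hρ a) (hderiv a)
  have hsecond (a b : 𝔥) (P : UnitaryComponent 𝒜) :
      mvfderiv 𝓘(ℝ, Skew 𝒜) (fun Q ↦ mvfderiv 𝓘(ℝ, Skew 𝒜) unitaryVal Q (L Q b)) P (L P a) =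
        fderiv ℝ (ρ b) (unitaryVal P) (ρ a (unitaryVal P)) := by
    have hcomp : HasMFDerivAt 𝓘(ℝ, Skew 𝒜) 𝓘(ℝ, 𝒜) (ρ b ∘ unitaryVal) P _ :=
      ((hρ b).differentiable (by simp) _).hasFDerivAt.hasMFDerivAt.comp P
        (contMDiff_unitaryVal.mdifferentiable (by simp) P).hasMFDerivAt
    rw [funext (hderiv b), ← hderiv a P]
    exact DFunLike.congr_fun hcomp.mfderiv (L P a)
  { frame := L
    contMDiff_frame := hsmooth
    bracket := bracket
    mlieBracket_frame a b P := by
      apply mvfderiv_unitaryVal_injective P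
      refine (mvfderiv_mlieBracket contMDiff_unitaryVal ((hsmooth a).mdifferentiable (by simp) P)
        ((hsmooth b).mdifferentiable (by simp) P)).trans ?_
      exact (congrArg₂ (· - ·) (hsecond a b P) (hsecond b a P)).trans
        ((hbracket a b _).trans (hderiv _ P).symm) }

end CayleyCoordinates

/-! ### Euclidean motions -/

section InnerProductForms

variable {V : Type*} [AddCommGroup V] [Module ℝ V] [FiniteDimensional ℝ V]

theorem exists_linearEquiv_inner (κ : LinearMap.BilinForm ℝ V) (hsymm : ∀ x y, κ x y = κ y x)
    (hpos : ∀ x, x ≠ 0 → 0 < κ x x) :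
    ∃ T : V ≃ₗ[ℝ] EuclideanSpace ℝ (Fin (Module.finrank ℝ V)), ∀ x y, ⟪T x, T y⟫_ℝ = κ x y := by
  let core : InnerProductSpace.Core ℝ V :=
    { inner x y := κ x y
      conj_inner_symm x y := hsymm y x
      re_inner_nonneg x := by
        rcases eq_or_ne x 0 with rfl | hx
        · simp
        · exact (hpos x hx).le
      add_left x y z := by simp
      smul_left x y r := by simp
      definite x hx := of_not_not fun h ↦ (hpos x h).ne' hx }
  let _ := core.toNormedAddCommGroup
  let _ : InnerProductSpace ℝ V := InnerProductSpace.ofCore core.toCore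
  exact ⟨(stdOrthonormalBasis ℝ V).repr.toLinearEquiv, (stdOrthonormalBasis ℝ V).repr.inner_map_map⟩

theorem trace_eq_zero_of_skew (κ : LinearMap.BilinForm ℝ V) (hsymm : ∀ x y, κ x y = κ y x)
    (hpos : ∀ x, x ≠ 0 → 0 < κ x x) (f : V →ₗ[ℝ] V) (hf : ∀ x, κ x (f x) = 0) :
    LinearMap.trace ℝ V f = 0 := by
  obtain ⟨T, hT⟩ := exists_linearEquiv_inner κ hsymm hpos
  rw [← LinearMap.trace_conj' f T, LinearMap.trace_eq_sum_inner _ (EuclideanSpace.basisFun _ ℝ)]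
  refine Finset.sum_eq_zero fun i _ ↦ ?_
  have h := hf (T.symm (EuclideanSpace.basisFun _ ℝ i))
  rwa [← hT, T.apply_symm_apply] at h

theorem trace_eq_trace_add_trace {V W : Type*} [AddCommGroup V] [Module ℝ V]
    [FiniteDimensional ℝ V] [AddCommGroup W] [Module ℝ W] [FiniteDimensional ℝ W]
    (f : V × W →ₗ[ℝ] V × W) :
    LinearMap.trace ℝ (V × W) f =
      LinearMap.trace ℝ V (LinearMap.fst ℝ V W ∘ₗ f ∘ₗ LinearMap.inl ℝ V W) +
        LinearMap.trace ℝ W (LinearMap.snd ℝ V W ∘ₗ f ∘ₗ LinearMap.inr ℝ V W) := by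
  have hid : f = (f ∘ₗ LinearMap.inl ℝ V W) ∘ₗ LinearMap.fst ℝ V W +
      (f ∘ₗ LinearMap.inr ℝ V W) ∘ₗ LinearMap.snd ℝ V W :=
    LinearMap.ext fun x ↦ by simp [← map_add]
  conv_lhs => rw [hid, map_add, LinearMap.trace_comp_comm' (LinearMap.fst ℝ V W),
    LinearMap.trace_comp_comm' (LinearMap.snd ℝ V W)]

end InnerProductForms

section EuclideanAlgebra

variable {H : Type*} [NormedAddCommGroup H] [InnerProductSpace ℝ H]

theorem trace_mul_comm_toLinearMap (a b : H →L[ℝ] H) :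
    LinearMap.trace ℝ H (a * b).toLinearMap = LinearMap.trace ℝ H (b * a).toLinearMap :=
  LinearMap.trace_mul_comm ℝ a.toLinearMap b.toLinearMap

variable [CompleteSpace H]

theorem inner_skew_apply (ξ : Skew (H →L[ℝ] H)) (x y : H) :
    ⟪(ξ : H →L[ℝ] H) x, y⟫_ℝ = -⟪x, (ξ : H →L[ℝ] H) y⟫_ℝ := by
  have h : ContinuousLinearMap.adjoint (ξ : H →L[ℝ] H) = -(ξ : H →L[ℝ] H) := ξ.2
  rw [← ContinuousLinearMap.adjoint_inner_right, h, neg_apply, inner_neg_right]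

theorem inner_skew_apply_self (ξ : Skew (H →L[ℝ] H)) (x : H) :
    ⟪x, (ξ : H →L[ℝ] H) x⟫_ℝ = 0 := by
  have h := inner_skew_apply ξ x x
  rw [real_inner_comm] at h
  linarith

theorem commutator_mem_skewAdjoint {R : Type*} [Ring R] [StarRing R] {a b : R}
    (ha : a ∈ skewAdjoint R) (hb : b ∈ skewAdjoint R) : a * b - b * a ∈ skewAdjoint R := by
  rw [skewAdjoint.mem_iff, star_sub, star_mul, star_mul, skewAdjoint.mem_iff.1 ha,
    skewAdjoint.mem_iff.1 hb]
  noncomm_ring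

variable (H) in
/-- The Lie bracket of the Lie algebra of Euclidean motions of `H`, a pair consisting of an
infinitesimal translation and an infinitesimal rotation. -/
def euclideanBracket : (H × Skew (H →L[ℝ] H)) →ₗ[ℝ] (H × Skew (H →L[ℝ] H)) →ₗ[ℝ]
    H × Skew (H →L[ℝ] H) :=
  LinearMap.mk₂ ℝ
    (fun a b ↦ ((a.2 : H →L[ℝ] H) b.1 - (b.2 : H →L[ℝ] H) a.1,
      ⟨a.2 * b.2 - b.2 * a.2, commutator_mem_skewAdjoint a.2.2 b.2.2⟩))
    (fun a a' b ↦ Prod.ext (by simp; abel) (Subtype.ext (by simp [mul_add, add_mul]; abel)))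
    (fun r a b ↦ Prod.ext (by simp [smul_sub]) (Subtype.ext (by simp [smul_sub])))
    (fun a b b' ↦ Prod.ext (by simp; abel) (Subtype.ext (by simp [mul_add, add_mul]; abel)))
    (fun r a b ↦ Prod.ext (by simp [smul_sub]) (Subtype.ext (by simp [smul_sub])))

theorem euclideanBracket_fst (a b : H × Skew (H →L[ℝ] H)) :
    (euclideanBracket H a b).1 = (a.2 : H →L[ℝ] H) b.1 - (b.2 : H →L[ℝ] H) a.1 := rfl

variable (H) in
/-- The invariant inner product `(ξ, η) ↦ -tr (ξ η)` on skew operators. -/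
def negTraceForm : LinearMap.BilinForm ℝ (Skew (H →L[ℝ] H)) :=
  -((LinearMap.mul ℝ (H →L[ℝ] H)).compr₂
    (LinearMap.trace ℝ H ∘ₗ ContinuousLinearMap.coeLM ℝ)).domRestrict₁₂ _ _

theorem negTraceForm_apply (ξ η : Skew (H →L[ℝ] H)) :
    negTraceForm H ξ η = -LinearMap.trace ℝ H (ξ * η : H →L[ℝ] H).toLinearMap := rfl

theorem negTraceForm_commutator (ξ η ζ : Skew (H →L[ℝ] H))
    (hζ : (ζ : H →L[ℝ] H) = ξ * η - η * ξ) : negTraceForm H η ζ = 0 := by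
  have h : (η * ζ : H →L[ℝ] H).toLinearMap =
      (η * ξ * η : H →L[ℝ] H).toLinearMap - (η * (η * ξ) : H →L[ℝ] H).toLinearMap := by
    rw [hζ, mul_sub, mul_assoc]
    rfl
  rw [negTraceForm_apply, h, map_sub, trace_mul_comm_toLinearMap (η * ξ : H →L[ℝ] H), sub_self,
    neg_zero]

variable [FiniteDimensional ℝ H]

theorem negTraceForm_pos {ξ : Skew (H →L[ℝ] H)} (hξ : ξ ≠ 0) : 0 < negTraceForm H ξ ξ := by
  let b := stdOrthonormalBasis ℝ H
  have hsum : negTraceForm H ξ ξ = ∑ i, ‖(ξ : H →L[ℝ] H) (b i)‖ ^ 2 := by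
    rw [negTraceForm_apply, LinearMap.trace_eq_sum_inner _ b, ← Finset.sum_neg_distrib]
    refine Finset.sum_congr rfl fun i _ ↦ ?_
    rw [← real_inner_self_eq_norm_sq, inner_skew_apply]
    rfl
  rw [hsum]
  refine Finset.sum_pos' (fun _ _ ↦ sq_nonneg _) ?_
  contrapose! hξ
  refine Subtype.ext (ContinuousLinearMap.coe_injective (b.toBasis.ext fun i ↦ ?_))
  have h := hξ i (Finset.mem_univ i)
  rw [b.coe_toBasis]
  exact norm_eq_zero.1 (sq_eq_zero_iff.1 (h.antisymm (sq_nonneg _)))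

theorem trace_skewAdjoint (ξ : Skew (H →L[ℝ] H)) :
    LinearMap.trace ℝ H (ξ : H →L[ℝ] H).toLinearMap = 0 :=
  trace_eq_zero_of_skew (innerₗ H) (fun x y ↦ real_inner_comm y x)
    (fun _ hx ↦ real_inner_self_pos.2 hx) _ (inner_skew_apply_self ξ)

theorem trace_euclideanBracket (a : H × Skew (H →L[ℝ] H)) :
    LinearMap.trace ℝ _ (euclideanBracket H a) = 0 := by
  have hfst : LinearMap.fst ℝ _ _ ∘ₗ euclideanBracket H a ∘ₗ LinearMap.inl ℝ _ _ =
      (a.2 : H →L[ℝ] H).toLinearMap :=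
    LinearMap.ext fun w ↦ sub_zero _
  rw [trace_eq_trace_add_trace, hfst, trace_skewAdjoint, zero_add]
  refine trace_eq_zero_of_skew (negTraceForm H)
    (fun ξ η ↦ congrArg Neg.neg (trace_mul_comm_toLinearMap _ _)) (fun _ ↦ negTraceForm_pos) _
    fun η ↦ negTraceForm_commutator a.2 η _ rfl

end EuclideanAlgebra

section TorusRotation

/-- The standard Euclidean space of dimension `n`. -/
abbrev Vec (n : ℕ) : Type := EuclideanSpace ℝ (Fin n)

/-- The algebra `ℂⁿ × End(ℝⁿ)`, in which the identity component of the unitary group is the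
manifold `Tⁿ × SO(n)`. -/
abbrev TorusRotation (n : ℕ) : Type := (Fin n → ℂ) × (Vec n →L[ℝ] Vec n)

variable {n : ℕ}

instance : NormedRing (TorusRotation n) := inferInstance
instance : NormedAlgebra ℝ (TorusRotation n) := inferInstance

variable (n) in
/-- The map `(u, A) ↦ (i u, A)`, which identifies `ℝⁿ × 𝔰𝔬(n)` with the Lie algebra of
`Tⁿ × SO(n)`. -/
def generator : (Vec n × (Vec n →L[ℝ] Vec n)) →L[ℝ] TorusRotation n :=
  (ContinuousLinearMap.pi fun j ↦ (EuclideanSpace.proj j).smulRight Complex.I).prodMap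
    (.id ℝ (Vec n →L[ℝ] Vec n))

theorem generator_mem_skewAdjoint (u : Vec n) (A : Skew (Vec n →L[ℝ] Vec n)) :
    generator n (u, A) ∈ skewAdjoint (TorusRotation n) := by
  refine Prod.ext (funext fun j ↦ ?_) A.2
  change star (u j • Complex.I) = -(u j • Complex.I)
  simp

variable (n) in
/-- The isomorphism of `ℝⁿ × 𝔰𝔬(n)` with the Lie algebra of `Tⁿ × SO(n)` given by `generator`. -/
def generatorEquiv : (Vec n × Skew (Vec n →L[ℝ] Vec n)) ≃ₗ[ℝ] Skew (TorusRotation n) where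
  toFun a := ⟨generator n (a.1, a.2), generator_mem_skewAdjoint a.1 a.2⟩
  invFun X := (WithLp.toLp 2 fun j ↦ ((X : TorusRotation n).1 j).im,
    ⟨(X : TorusRotation n).2, congrArg Prod.snd X.2⟩)
  map_add' a b := Subtype.ext (map_add (generator n) (a.1, (a.2 : Vec n →L[ℝ] Vec n)) (b.1, b.2))
  map_smul' r a := Subtype.ext (map_smul (generator n) r (a.1, (a.2 : Vec n →L[ℝ] Vec n)))
  left_inv a := by
    refine Prod.ext (PiLp.ext fun j ↦ ?_) rfl
    change (a.1 j • Complex.I).im = a.1 j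
    simp
  right_inv X := by
    refine Subtype.ext (Prod.ext (funext fun j ↦ ?_) rfl)
    have hskew : star ((X : TorusRotation n).1 j) = -(X : TorusRotation n).1 j :=
      congrFun (congrArg Prod.fst X.2) j
    have hre : ((X : TorusRotation n).1 j).re = 0 := by
      have h := congrArg Complex.re hskew
      rw [Complex.star_def, Complex.conj_re, Complex.neg_re] at h
      linarith
    change ((X : TorusRotation n).1 j).im • Complex.I = (X : TorusRotation n).1 j
    apply Complex.ext <;> simp [hre]

/-- The vector field on `Tⁿ × SO(n)` of constant body angular velocity `A` and of constant
space translation velocity `v`, extended to the ambient algebra. -/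
def bodyField (a : Vec n × Skew (Vec n →L[ℝ] Vec n)) (X : TorusRotation n) : TorusRotation n :=
  X * generator n (X.2 a.1, a.2)

theorem fderiv_bodyField (a : Vec n × Skew (Vec n →L[ℝ] Vec n)) (X Y : TorusRotation n) :
    fderiv ℝ (bodyField a) X Y =
      X * generator n (Y.2 a.1, 0) + Y * generator n (X.2 a.1, a.2) := by
  let ev : TorusRotation n →L[ℝ] Vec n := ContinuousLinearMap.apply ℝ (Vec n) a.1 ∘L .snd ℝ _ _
  have hpair : HasFDerivAt (fun Z : TorusRotation n ↦ (Z.2 a.1, (a.2 : Vec n →L[ℝ] Vec n)))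
      (ev.prod 0) X :=
    ev.hasFDerivAt.prodMk (hasFDerivAt_const (a.2 : Vec n →L[ℝ] Vec n) X)
  have hgen : HasFDerivAt (fun Z : TorusRotation n ↦ generator n (Z.2 a.1, a.2))
      (generator n ∘L ev.prod 0) X := (generator n).hasFDerivAt.comp X hpair
  exact DFunLike.congr_fun ((hasFDerivAt_id X).mul' hgen).fderiv Y

theorem contDiff_bodyField (a : Vec n × Skew (Vec n →L[ℝ] Vec n)) :
    ContDiff ℝ ∞ (bodyField a) := by
  unfold bodyField
  exact contDiff_id.mul ((generator n).contDiff.comp ((contDiff_snd.clm_apply contDiff_const).prodMk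
    contDiff_const))

theorem bodyField_bracket (a b : Vec n × Skew (Vec n →L[ℝ] Vec n)) (X : TorusRotation n) :
    fderiv ℝ (bodyField b) X (bodyField a X) - fderiv ℝ (bodyField a) X (bodyField b X) =
      bodyField (euclideanBracket (Vec n) a b) X := by
  simp only [fderiv_bodyField]
  refine Prod.ext (funext fun j ↦ ?_) ?_
  · change X.1 j * ((X.2 ((a.2 : Vec n →L[ℝ] Vec n) b.1)) j • Complex.I) +
        X.1 j * (X.2 a.1 j • Complex.I) * (X.2 b.1 j • Complex.I) -
      (X.1 j * ((X.2 ((b.2 : Vec n →L[ℝ] Vec n) a.1)) j • Complex.I) +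
        X.1 j * (X.2 b.1 j • Complex.I) * (X.2 a.1 j • Complex.I)) =
      X.1 j * (X.2 ((a.2 : Vec n →L[ℝ] Vec n) b.1 - (b.2 : Vec n →L[ℝ] Vec n) a.1) j • Complex.I)
    rw [map_sub, PiLp.sub_apply, sub_smul]
    ring
  · change X.2 * 0 + X.2 * a.2 * b.2 - (X.2 * 0 + X.2 * b.2 * a.2) =
      X.2 * ((a.2 : Vec n →L[ℝ] Vec n) * b.2 - b.2 * a.2)
    rw [mul_sub, mul_zero, zero_add, zero_add, mul_assoc, mul_assoc]

/-- The orthogonal map through which a point of `Tⁿ × SO(n)` acts on `ℝⁿ`. -/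
def rotation (P : UnitaryComponent (TorusRotation n)) : Vec n ≃ₗᵢ[ℝ] Vec n :=
  Unitary.linearIsometryEquiv ⟨(unitaryVal P).2,
    congrArg Prod.snd (star_unitaryVal_mul P), congrArg Prod.snd (unitaryVal_mul_star P)⟩

variable (n) in
/-- The frame of `Tⁿ × SO(n)` by the fields `bodyField`, whose Lie algebra is that of the Euclidean
motions of `ℝⁿ`. -/
def bodyFraming : LieFraming (Skew (TorusRotation n)) (UnitaryComponent (TorusRotation n))
    (Vec n × Skew (Vec n →L[ℝ] Vec n)) :=
  unitaryFraming bodyField contDiff_bodyField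
    (fun P ↦ (((rotation P).toLinearEquiv.prodCongr (.refl ℝ _)).trans
      (generatorEquiv n)).toContinuousLinearEquiv)
    (fun _ _ ↦ rfl) (euclideanBracket (Vec n)).toContinuousBilinearMap bodyField_bracket

theorem bodyFraming_bracket (a b : Vec n × Skew (Vec n →L[ℝ] Vec n)) :
    (bodyFraming n).bracket a b = euclideanBracket (Vec n) a b := rfl

end TorusRotation

section Realization

theorem exists_skew_apply_self {H : Type*} [NormedAddCommGroup H] [InnerProductSpace ℝ H]
    [FiniteDimensional ℝ H] [CompleteSpace H] (B : H →ₗ[ℝ] H →ₗ[ℝ] H)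
    (hB : ∀ y, ⟪B y y, y⟫_ℝ = 0) :
    ∃ A : H →L[ℝ] Skew (H →L[ℝ] H), ∀ y, (A y : H →L[ℝ] H) y = B y y := by
  let C : H →L[ℝ] H →L[ℝ] H := (B + B.flip).toContinuousBilinearMap
  have hC (y w : H) : C y w = B y w + B w y := rfl
  have hpolar (y w : H) : ⟪y, C y w⟫_ℝ = -⟪B y y, w⟫_ℝ := by
    have hadd := hB (y + w)
    have hsub := hB (y - w)
    simp only [map_add, map_sub, LinearMap.add_apply, LinearMap.sub_apply, inner_add_left,
      inner_add_right, inner_sub_left, inner_sub_right] at hadd hsub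
    rw [real_inner_comm, hC, inner_add_left]
    linarith [hB y, hB w]
  -- By `hpolar`, `C y y - (C y)† y = 2 B(y, y) + B(y, y)`, and `skewPart` halves this.
  refine ⟨(2 / 3 : ℝ) • skewPart (H →L[ℝ] H) ∘L C, fun y ↦ ?_⟩
  refine ext_inner_right ℝ fun w ↦ ?_
  have hA : (((2 / 3 : ℝ) • skewPart (H →L[ℝ] H) ∘L C) y : H →L[ℝ] H) y =
      (2 / 3 : ℝ) • (2 : ℝ)⁻¹ • (C y y - ContinuousLinearMap.adjoint (C y) y) := rfl
  rw [hA, inner_smul_left, inner_smul_left, inner_sub_left, ContinuousLinearMap.adjoint_inner_left,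
    hpolar, hC, inner_add_left]
  simp only [conj_trivial]
  ring

/-- The linear isomorphism `(u, w) ↦ (u, S w + A u)`, which identifies a Euclidean space with the
Lie algebra of Euclidean motions. -/
def shear {n d : ℕ} (S : Vec d ≃L[ℝ] Skew (Vec n →L[ℝ] Vec n))
    (A : Vec n →L[ℝ] Skew (Vec n →L[ℝ] Vec n)) :
    WithLp 2 (Vec n × Vec d) ≃L[ℝ] Vec n × Skew (Vec n →L[ℝ] Vec n) :=
  (WithLp.prodContinuousLinearEquiv 2 ℝ (Vec n) (Vec d)).trans
    (ContinuousLinearEquiv.skewProd (.refl ℝ (Vec n)) S A)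

theorem shear_toLp {n d : ℕ} (S : Vec d ≃L[ℝ] Skew (Vec n →L[ℝ] Vec n))
    (A : Vec n →L[ℝ] Skew (Vec n →L[ℝ] Vec n)) (u : Vec n) (w : Vec d) :
    shear S A (WithLp.toLp 2 (u, w)) = (u, S w + A u) := rfl

theorem shear_symm_fst {n d : ℕ} (S : Vec d ≃L[ℝ] Skew (Vec n →L[ℝ] Vec n))
    (A : Vec n →L[ℝ] Skew (Vec n →L[ℝ] Vec n)) (a : Vec n × Skew (Vec n →L[ℝ] Vec n)) :
    ((shear S A).symm a).fst = a.1 := rfl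

theorem trace_reparam_bodyFraming {n : ℕ} {𝔥 : Type*} [NormedAddCommGroup 𝔥] [NormedSpace ℝ 𝔥]
    (T : 𝔥 ≃L[ℝ] Vec n × Skew (Vec n →L[ℝ] Vec n)) (a : 𝔥) :
    LinearMap.trace ℝ 𝔥 (((bodyFraming n).reparam T).bracket a).toLinearMap = 0 :=
  (LinearMap.trace_conj' (euclideanBracket (Vec n) (T a)) T.symm.toLinearEquiv).trans
    (trace_euclideanBracket (T a))

theorem adjoint_sheared_bracket {n d : ℕ} (S : Vec d ≃L[ℝ] Skew (Vec n →L[ℝ] Vec n))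
    (A : Vec n →L[ℝ] Skew (Vec n →L[ℝ] Vec n)) (u : Vec n) :
    ContinuousLinearMap.adjoint (((bodyFraming n).reparam (shear S A)).bracket
        (WithLp.toLp 2 (u, 0))) (WithLp.toLp 2 (u, 0)) =
      WithLp.toLp 2 (-(A u : Vec n →L[ℝ] Vec n) u, 0) := by
  refine ext_inner_right ℝ fun w ↦ ?_
  have hfst : (((bodyFraming n).reparam (shear S A)).bracket (WithLp.toLp 2 (u, 0)) w).fst =
      (A u : Vec n →L[ℝ] Vec n) w.fst - ((shear S A w).2 : Vec n →L[ℝ] Vec n) u := by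
    rw [LieFraming.reparam_bracket_apply, shear_symm_fst, bodyFraming_bracket, euclideanBracket_fst,
      shear_toLp, map_zero, zero_add]
    rfl
  rw [ContinuousLinearMap.adjoint_inner_left, WithLp.prod_inner_apply, WithLp.prod_inner_apply]
  change ⟪u, (((bodyFraming n).reparam (shear S A)).bracket (WithLp.toLp 2 (u, 0)) w).fst⟫_ℝ +
    ⟪(0 : Vec d), _⟫_ℝ = ⟪-(A u : Vec n →L[ℝ] Vec n) u, w.fst⟫_ℝ + ⟪(0 : Vec d), _⟫_ℝ
  rw [hfst, inner_zero_left, inner_zero_left, inner_sub_right, inner_skew_apply_self, sub_zero,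
    inner_neg_left, inner_skew_apply, neg_neg]

variable {V : Type*} [NormedAddCommGroup V] [NormedSpace ℝ V] [FiniteDimensional ℝ V]

theorem exists_embedsIntoEuler_of_conserved (B : V →ₗ[ℝ] V →ₗ[ℝ] V) (Q : LinearMap.BilinForm ℝ V)
    (hsymm : ∀ y z, Q y z = Q z y) (hpos : ∀ y, y ≠ 0 → 0 < Q y y) (hQ : ∀ y, Q (B y y) y = 0) :
    ∃ N : CompactRiemannianManifold, EmbedsIntoEuler B N := by
  obtain ⟨T, hT⟩ := exists_linearEquiv_inner Q hsymm hpos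
  let B' := (B.compl₁₂ T.symm.toLinearMap T.symm.toLinearMap).compr₂ T.toLinearMap
  have hB' (u) : B' u u = T (B (T.symm u) (T.symm u)) := rfl
  obtain ⟨A, hA⟩ := exists_skew_apply_self B' fun u ↦ by
    rw [hB', ← T.apply_symm_apply u, hT, T.symm_apply_apply, hQ]
  let n := Module.finrank ℝ V
  let d := Module.finrank ℝ (Skew (Vec n →L[ℝ] Vec n))
  let S : Vec d ≃L[ℝ] Skew (Vec n →L[ℝ] Vec n) :=
    ContinuousLinearEquiv.ofFinrankEq finrank_euclideanSpace_fin
  let U : V →ₗ[ℝ] WithLp 2 (Vec n × Vec d) :=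
    (WithLp.linearEquiv 2 ℝ _).symm.toLinearMap ∘ₗ LinearMap.inl ℝ _ _ ∘ₗ T.toLinearMap
  refine ⟨_, ((bodyFraming n).reparam (shear S (-A))).embedsIntoEuler B U ?_ (fun y ↦ ?_)
    fun y ↦ trace_reparam_bodyFraming _ _⟩
  · exact (WithLp.linearEquiv 2 ℝ _).symm.injective.comp
      (LinearMap.inl_injective.comp T.injective)
  · refine (adjoint_sheared_bracket S (-A) (T y)).trans ?_
    have h : -(((-A) (T y) : Skew (Vec n →L[ℝ] Vec n)) : Vec n →L[ℝ] Vec n) (T y) =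
        T (B y y) := by
      refine (neg_neg _).trans ((hA (T y)).trans ?_)
      rw [hB', T.symm_apply_apply]
    rw [h]
    rfl

end Realization

end EulerEmbedding

end

theorem theorem1p1_general {V : Type*} [NormedAddCommGroup V] [NormedSpace ℝ V]
    [FiniteDimensional ℝ V] (B : V →ₗ[ℝ] V →ₗ[ℝ] V) :
    (∃ N : EulerEmbedding.CompactRiemannianManifold, EulerEmbedding.EmbedsIntoEuler B N) ↔
      ∃ Q : LinearMap.BilinForm ℝ V,
        (∀ y z, Q y z = Q z y) ∧ (∀ y, y ≠ 0 → 0 < Q y y) ∧ ∀ y, Q (B y y) y = 0 :=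
  ⟨fun ⟨_, h⟩ ↦ EulerEmbedding.exists_conserved_of_embedsIntoEuler h,
    fun ⟨Q, hsymm, hpos, hQ⟩ ↦
      EulerEmbedding.exists_embedsIntoEuler_of_conserved B Q hsymm hpos hQ⟩

theorem theorem1p1 (n : ℕ)
    (B : EuclideanSpace ℝ (Fin n) →ₗ[ℝ] EuclideanSpace ℝ (Fin n) →ₗ[ℝ] EuclideanSpace ℝ (Fin n))
    (hB : ∀ y z, B y z = B z y) :
    (∃ N : EulerEmbedding.CompactRiemannianManifold, EulerEmbedding.EmbedsIntoEuler B N) ↔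
      ∃ Q : LinearMap.BilinForm ℝ (EuclideanSpace ℝ (Fin n)),
        (∀ y z, Q y z = Q z y) ∧ (∀ y, y ≠ 0 → 0 < Q y y) ∧ ∀ y, Q (B y y) y = 0 :=
  theorem1p1_general B
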